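/- **Lemma (Uniform a priori bounds).** For $\varepsilon\in(0,1)$ consider the isothermal relativistic Euler equations (sound speed $1$, light speed $1/\varepsilon$) $$\partial_t G+\partial_x H=0,\qquad \partial_t H+\partial_x F=0,$$ $$G=\frac{1+\varepsilon^4v^2}{1-\varepsilon^2v^2}\,\rho,\qquad H=\frac{1+\varepsilon^2}{1-\varepsilon^2v^2}\,\rho v,\qquad F=\frac{1+v^2}{1-\varepsilon^2v^2}\,\rho,$$ for the density $\rho\ge 0$ and the velocity $v$, where $|v|<1/\varepsilon$ if $\rho>0$, while in the vacuum $\rho=0$ the velocity is an arbitrary number with $|v|\le 1/\varepsilon$ and $G=H=F=0$. Put $\varepsilon'=2\varepsilon/(1+\varepsilon^2)$ and, for $M>0$, $$\mathcal T_\varepsilon(M)=\{(\rho,v): 0\le\rho\le M,\ 1-\varepsilon|v|\ge(\rho/M)^{\varepsilon'}\}.$$ *Riemann solutions.* A solution of the Riemann problem with left state $u_l$ and right state $u_r$ is a self-similar, piecewise $C^1$ function $(\rho,v)(x/t)$ with these data. In conservative variables $(G,H)$ it is $C^1$ and satisfies the equations away from finitely many values of $x/t$. At those values it has one-sided limits and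 takes the value of one of them, and the jump satisfies the Rankine–Hugoniot relations and the entropy inequality of every smooth weak entropy pair (one vanishing in the vacuum and continuous on each tame region) whose entropy is convex in $(G,H)$. *Lax–Friedrichs approximations.* Let $\tau,h>0$, $t_n=n\tau$ ($n\ge0$), $x_j=jh$ ($j\in\mathbb Z$). An approximation $(\rho^h,v^h)$ with initial data $(\rho_0,v_0)$ is given by cell states $(\rho_j^n,v_j^n)$, $n+j$ even, as follows. At time $t_n$ it equals $(\rho_j^n,v_j^n)$ on $[x_{j-1},x_{j+1})$. For $t_n<t<t_{n+1}$ and $x\in[x_j,x_{j+2})$, with $n+j$ even, it equals a solution of the Riemann problem with states $(\rho_j^n,v_j^n)$, $(\rho_{j+2}^n,v_{j+2}^n)$, centred at $(t_n,x_{j+1})$. The state $(\rho^{n+1}_{j+1},v^{n+1}_{j+1})$ is the one whose conservative variables $(G,H)$ are the averages over $(x_j,x_{j+2})$ of those of this Riemann solution at time $t_{n+1}-0$. In the same way $(\rho^0_j,v^0_j)$, $j$ even, is the state whose conservative variables are the averages over $(x_{j-1},x_{j+1})$ of those of $(\rho_0,v_0)$. *Claim.* Let $\varepsilon_0\in(0,1)$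 and let $\rho_0,v_0:\mathbb R\to\mathbb R$ be measurable with range included in $\mathcal T_{\varepsilon_0}(M_0)$ for some $M_0>0$. Then there is a constant $M>0$, depending only on $\varepsilon_0$ and $(\rho_0,v_0)$, such that for all $\varepsilon\in(0,\varepsilon_0]$ (in particular for $\varepsilon=\varepsilon_0$), all $\tau,h>0$ and every Lax–Friedrichs approximation $(\rho^h,v^h)$ with initial data $(\rho_0,v_0)$ that satisfies the CFL condition $$\frac{\tau}{h}\,\frac{|v^h(t,x)|+1}{1-\varepsilon^2|v^h(t,x)|}<\frac12\qquad\text{for all } t\ge0,\ x\in\mathbb R,$$ one has, for all $t\ge0$ and $x\in\mathbb R$, $$0\le\rho^h(t,x)\le M,\qquad 1-\varepsilon|v^h(t,x)|\ge\big(\rho^h(t,x)/M\big)^{\varepsilon'}.$$ -/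

import Mathlib

open Filter Topology
open scoped ContDiff

noncomputable section

namespace RelEuler

/-! A state is a pair `u = (ρ, v)`: mass density `u.1`, velocity `u.2`. The sound speed is
normalized to `1` and the light speed is `1 / ε`. -/

/-- Conserved energy density `G = (1 + ε⁴ v²) ρ / (1 - ε² v²)`. -/
def G (ε : ℝ) (u : ℝ × ℝ) : ℝ :=
  (1 + ε ^ 4 * u.2 ^ 2) / (1 - ε ^ 2 * u.2 ^ 2) * u.1

/-- Conserved momentum density `H = (1 + ε²) ρ v / (1 - ε² v²)`. -/
def H (ε : ℝ) (u : ℝ × ℝ) : ℝ :=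
  (1 + ε ^ 2) / (1 - ε ^ 2 * u.2 ^ 2) * u.1 * u.2

/-- Momentum flux `F = (1 + v²) ρ / (1 - ε² v²)`. -/
def F (ε : ℝ) (u : ℝ × ℝ) : ℝ :=
  (1 + u.2 ^ 2) / (1 - ε ^ 2 * u.2 ^ 2) * u.1

/-- The conservative variables. The Euler equations are
`∂ₜ G + ∂ₓ H = 0`, `∂ₜ H + ∂ₓ F = 0`. -/
def cons (ε : ℝ) (u : ℝ × ℝ) : ℝ × ℝ := (G ε u, H ε u)

/-- Physical states: nonnegative density, velocity below the light speed; in the vacuum (where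
the velocity has no meaning and `G = H = F = 0`) the value `|v| = 1 / ε` is permitted. -/
def phaseSpace (ε : ℝ) : Set (ℝ × ℝ) :=
  {u | 0 ≤ u.1 ∧ ε * |u.2| ≤ 1 ∧ (0 < u.1 → ε * |u.2| < 1)}

/-- Non-vacuum physical states. -/
def interiorStates (ε : ℝ) : Set (ℝ × ℝ) :=
  {u | 0 < u.1 ∧ ε * |u.2| < 1}

/-- The exponent `ε' = 2 ε / (1 + ε²)`. -/
def tameExponent (ε : ℝ) : ℝ := 2 * ε / (1 + ε ^ 2)

/-- The tame region `0 ≤ ρ ≤ M`, `1 - ε |v| ≥ (ρ / M) ^ ε'`. -/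
def tameRegion (ε M : ℝ) : Set (ℝ × ℝ) :=
  {u | 0 ≤ u.1 ∧ u.1 ≤ M ∧ (u.1 / M) ^ tameExponent ε ≤ 1 - ε * |u.2|}

/-- Tame initial data: measurable, with range included in some tame region (hence bounded). -/
def IsTameData (ε : ℝ) (u₀ : ℝ → ℝ × ℝ) : Prop :=
  Measurable u₀ ∧ ∃ M : ℝ, 0 < M ∧ ∀ x, u₀ x ∈ tameRegion ε M

/-- First characteristic speed. -/
def lam₁ (ε : ℝ) (u : ℝ × ℝ) : ℝ := (u.2 - 1) / (1 - ε ^ 2 * u.2)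

/-- Second characteristic speed. -/
def lam₂ (ε : ℝ) (u : ℝ × ℝ) : ℝ := (u.2 + 1) / (1 + ε ^ 2 * u.2)

/-- First characteristic direction in the `(ρ, v)` plane. -/
def r₁ (ε : ℝ) (u : ℝ × ℝ) : ℝ × ℝ :=
  (-1 / (1 - ε ^ 2 * u.2 ^ 2), 1 / ((1 + ε ^ 2) * u.1))

/-- Second characteristic direction in the `(ρ, v)` plane. -/
def r₂ (ε : ℝ) (u : ℝ × ℝ) : ℝ × ℝ :=
  (1 / (1 - ε ^ 2 * u.2 ^ 2), 1 / ((1 + ε ^ 2) * u.1))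

/-- `(U, Q)` is a smooth weak entropy pair (entropy, entropy flux), with `U` convex. -/
structure IsConvexWeakEntropyPair (ε : ℝ) (U Q : ℝ × ℝ → ℝ) : Prop where
  smooth_U : ContDiffOn ℝ ∞ U (interiorStates ε)
  smooth_Q : ContDiffOn ℝ ∞ Q (interiorStates ε)
  /-- The compatibility conditions `∇Q · rⱼ = λⱼ ∇U · rⱼ`. -/
  compat₁ : ∀ u ∈ interiorStates ε,
    fderiv ℝ Q u (r₁ ε u) = lam₁ ε u * fderiv ℝ U u (r₁ ε u)
  compat₂ : ∀ u ∈ interiorStates ε,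
    fderiv ℝ Q u (r₂ ε u) = lam₂ ε u * fderiv ℝ U u (r₂ ε u)
  continuousOn_U : ∀ M : ℝ, 0 < M → ContinuousOn U (tameRegion ε M)
  continuousOn_Q : ∀ M : ℝ, 0 < M → ContinuousOn Q (tameRegion ε M)
  /-- The pair vanishes on the vacuum. -/
  vacuum : ∀ v : ℝ, ε * |v| ≤ 1 → U (0, v) = 0 ∧ Q (0, v) = 0
  /-- `U` is a convex function of the conservative variables `(G, H)`, which range over the
  cone `ε |H| < G` when `(ρ, v)` ranges over the non-vacuum states. -/
  convex : ∃ Φ : ℝ × ℝ → ℝ, ConvexOn ℝ {p : ℝ × ℝ | ε * |p.2| < p.1} Φ ∧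
    ∀ u ∈ interiorStates ε, U u = Φ (cons ε u)

/-- The jump from the left state `a` to the right state `b`, travelling at speed `s`, satisfies
the Rankine-Hugoniot relations and all the entropy inequalities. Trivial jumps are included. -/
def IsEntropyJump (ε s : ℝ) (a b : ℝ × ℝ) : Prop :=
  H ε b - H ε a = s * (G ε b - G ε a) ∧
  F ε b - F ε a = s * (H ε b - H ε a) ∧
  ∀ U Q : ℝ × ℝ → ℝ, IsConvexWeakEntropyPair ε U Q → Q b - Q a ≤ s * (U b - U a)

/-- `(t, x) ↦ r (x / t)` is a self-similar, piecewise smooth entropy solution of the Euler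
equations, for the initial data equal to `ul` for `x < 0` and to `ur` for `x > 0`. Convergence is
expressed in the conservative variables, since the velocity has no meaning in the vacuum. -/
structure IsRiemannSolution (ε : ℝ) (ul ur : ℝ × ℝ) (r : ℝ → ℝ × ℝ) : Prop where
  mem_phaseSpace : ∀ ξ, r ξ ∈ phaseSpace ε
  left_data : Tendsto (fun ξ => cons ε (r ξ)) atBot (𝓝 (cons ε ul))
  right_data : Tendsto (fun ξ => cons ε (r ξ)) atTop (𝓝 (cons ε ur))
  /-- Outside of finitely many speeds `ξ` the solution is `C¹` and satisfies
  `- ξ G' + H' = 0`, `- ξ H' + F' = 0`, that is the Euler equations for functions of `ξ = x / t`.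
  At the exceptional speeds it has one-sided limits, which form an entropy admissible jump. -/
  piecewise : ∃ S : Finset ℝ,
    (∀ ξ, ξ ∉ S →
      ContDiffAt ℝ 1 (fun η => cons ε (r η)) ξ ∧
      HasDerivAt (fun η => H ε (r η)) (ξ * deriv (fun η => G ε (r η)) ξ) ξ ∧
      HasDerivAt (fun η => F ε (r η)) (ξ * deriv (fun η => H ε (r η)) ξ) ξ) ∧
    (∀ s ∈ S, ∃ a ∈ phaseSpace ε, ∃ b ∈ phaseSpace ε,
      Tendsto (fun ξ => cons ε (r ξ)) (𝓝[<] s) (𝓝 (cons ε a)) ∧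
      Tendsto (fun ξ => cons ε (r ξ)) (𝓝[>] s) (𝓝 (cons ε b)) ∧
      (r s = a ∨ r s = b) ∧
      IsEntropyJump ε s a b)

/-- The state `c` is the average over the interval `(x₀ - h, x₀ + h)` of the state field `u`:
the conservative variables of `c` are the means of those of `u`. -/
def IsCellAverage (ε h x₀ : ℝ) (u : ℝ → ℝ × ℝ) (c : ℝ × ℝ) : Prop :=
  c ∈ phaseSpace ε ∧
  G ε c = (2 * h)⁻¹ * ∫ x in (x₀ - h)..(x₀ + h), G ε (u x) ∧
  H ε c = (2 * h)⁻¹ * ∫ x in (x₀ - h)..(x₀ + h), H ε (u x)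

/-- `uh = (ρʰ, vʰ)`, a function of `t` and `x`, is the Lax-Friedrichs approximation with time
length `τ` and space length `h` issued from the initial data `u₀`. Here `tₙ = n τ`, `xⱼ = j h`, and
`cell n j`, used for `n + j` even only, is the state in the cell `[xⱼ₋₁, xⱼ₊₁)` at time `tₙ`. -/
def IsLaxFriedrichs (ε τ h : ℝ) (u₀ : ℝ → ℝ × ℝ) (uh : ℝ → ℝ → ℝ × ℝ) : Prop :=
  ∃ cell : ℕ → ℤ → ℝ × ℝ,
    -- the initial data are averaged over each cell
    (∀ j : ℤ, Even j → IsCellAverage ε h (j * h) u₀ (cell 0 j)) ∧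
    -- at time `tₙ` the approximation is constant in each cell
    (∀ (n : ℕ) (j : ℤ), Even ((n : ℤ) + j) →
      ∀ x ∈ Set.Ico ((j - 1 : ℝ) * h) ((j + 1 : ℝ) * h), uh (n * τ) x = cell n j) ∧
    -- for `tₙ < t < tₙ₊₁` it is given by the Riemann problem at the interface `xⱼ₊₁`, whose
    -- solution at time `tₙ₊₁ - 0` is then averaged over the interval from `xⱼ` to `xⱼ₊₂`
    (∀ (n : ℕ) (j : ℤ), Even ((n : ℤ) + j) →
      ∃ r : ℝ → ℝ × ℝ, IsRiemannSolution ε (cell n j) (cell n (j + 2)) r ∧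
        (∀ t ∈ Set.Ioo ((n : ℝ) * τ) ((n + 1 : ℝ) * τ),
          ∀ x ∈ Set.Ico ((j : ℝ) * h) ((j + 2 : ℝ) * h),
            uh t x = r ((x - (j + 1) * h) / (t - n * τ))) ∧
        IsCellAverage ε h ((j + 1) * h) (fun x => r ((x - (j + 1) * h) / τ))
          (cell (n + 1) (j + 1)))

/-- The CFL stability condition `(τ / h) (|vʰ| + 1) / (1 - ε² |vʰ|) < 1 / 2`, for all `(t, x)`. -/
def CFL (ε τ h : ℝ) (uh : ℝ → ℝ → ℝ × ℝ) : Prop :=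
  ∀ t x : ℝ, 0 ≤ t → τ / h * ((|(uh t x).2| + 1) / (1 - ε ^ 2 * |(uh t x).2|)) < 1 / 2

end RelEuler

end

/-! With the boost factor `y = (1 + εv)/(1 - εv)` and `k = (1 + ε²)/(2ε) = 1/ε'`, the Riemann
invariants are `ρ y^k` and `ρ y^(-k)`. Up to a change of the constant, a tame region is a bound on
both of them (`invRegion`), and this bound survives both steps of the scheme.

Riemann problems: none is ever solved. The combinations `G - ε²F` and `G ± 2εH + ε²F` are multiples
of `ρ`, `ρ y` and `ρ / y`, so the Rankine–Hugoniot relations and the equations for smooth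
self-similar flow become linear in these null variables, with coefficients built from `1 ± εξ`. A
single entropy, minus the particle number, suffices: its inequality forces a nontrivial jump of
speed `s` to satisfy `λ₂ > s` on its left and not to increase `ρ^ε' y` from left to right
(`lax_of_ratio`, `IsNullJump.lax`). In smooth flow this invariant is stationary where `λ₂ > ξ` and
nondecreasing where `λ₂ ≤ ξ`. Take a non-vacuum state at `ξ`. If `λ₂ ≤ ξ`, this persists to the
right, no shock is met, and the invariant does not decrease on the way to the right datum
(`IsProfile.forward`). If `λ₂ > ξ`, this persists to the left, and the invariant does not decrease
on the way to the left datum (`IsProfile.backward`). Hence one of the data dominates; reflection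
treats the other invariant.

Averaging: in the variables `(G, H)` the bound `ρ y^k ≤ M` is an intersection of half-planes, one
for each tangent of the boundary curve (`rpow_neg_mul_le`, `support_le`, `le_of_support_le`), and
linear inequalities pass to means.

Uniformity in `ε`: for fixed `v ≥ 0` the quantity `y^k` increases with `ε` (`boost_rpow_mono`), so
the bound on the data at `ε₀` yields one constant for all `ε ≤ ε₀`. -/

noncomputable section

namespace RelEuler

/-! ### Null variables and their recovery from the conservative variables. -/

/-- The boost factor `(1 + ε v) / (1 - ε v)` of a velocity. -/
def boost (ε v : ℝ) : ℝ := (1 + ε * v) / (1 - ε * v)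

/-- The ratio `(1 - ε) / (1 + ε)`. -/
def kap (ε : ℝ) : ℝ := (1 - ε) / (1 + ε)

/-- The ratio `(1 - ε²) / (1 + ε²)`. -/
def del (ε : ℝ) : ℝ := (1 - ε ^ 2) / (1 + ε ^ 2)

/-- The density and the two null components of the energy-momentum tensor, up to constants. -/
def nullState (ε : ℝ) (u : ℝ × ℝ) : ℝ × ℝ × ℝ :=
  (u.1, u.1 * boost ε u.2, u.1 / boost ε u.2)

/-- The density as a function of the conservative variables. -/
def rhoOf (ε : ℝ) (p : ℝ × ℝ) : ℝ :=
  (-((1 - ε ^ 2) * p.1) + √(((1 - ε ^ 2) * p.1) ^ 2 + 4 * ε ^ 2 * (p.1 ^ 2 - ε ^ 2 * p.2 ^ 2))) /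
    (2 * ε ^ 2)

/-- The null components as functions of the conservative variables. -/
def nullOf (ε : ℝ) (p : ℝ × ℝ) : ℝ × ℝ × ℝ :=
  (rhoOf ε p,
    (p.1 + 2 * ε * p.2 + (p.1 - (1 - ε ^ 2) * rhoOf ε p)) / (1 + ε ^ 2),
    (p.1 - 2 * ε * p.2 + (p.1 - (1 - ε ^ 2) * rhoOf ε p)) / (1 + ε ^ 2))

variable {ε : ℝ}

lemma one_sub_pos_of_abs {v : ℝ} (h0 : 0 < ε) (hv : ε * |v| < 1) :
    0 < 1 - ε * v ∧ 0 < 1 + ε * v := by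
  have h1 := mul_le_mul_of_nonneg_left (le_abs_self v) h0.le
  have h2 := mul_le_mul_of_nonneg_left (neg_abs_le v) h0.le
  constructor <;> linarith

lemma boost_pos {v : ℝ} (h0 : 0 < ε) (hv : ε * |v| < 1) : 0 < boost ε v := by
  obtain ⟨h1, h2⟩ := one_sub_pos_of_abs h0 hv
  exact div_pos h2 h1

lemma boost_neg (ε v : ℝ) : boost ε (-v) = (boost ε v)⁻¹ := by
  simp [boost, sub_eq_add_neg]

lemma one_sub_sq_pos {v : ℝ} (h0 : 0 < ε) (hv : ε * |v| < 1) : 0 < 1 - ε ^ 2 * v ^ 2 := by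
  obtain ⟨h1, h2⟩ := one_sub_pos_of_abs h0 hv
  nlinarith [mul_pos h1 h2]

lemma mem_interior_or_vacuum {u : ℝ × ℝ} (hu : u ∈ phaseSpace ε) :
    u ∈ interiorStates ε ∨ u.1 = 0 := by
  rcases hu.1.eq_or_lt with h | h
  · exact Or.inr h.symm
  · exact Or.inl ⟨h, hu.2.2 h⟩

lemma interior_subset_phaseSpace {u : ℝ × ℝ} (hu : u ∈ interiorStates ε) : u ∈ phaseSpace ε :=
  ⟨hu.1.le, hu.2.le, fun _ => hu.2⟩

/-- This identity and the next two diagonalize the energy-momentum tensor in light-cone directions: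
all jump and derivative relations for `G`, `H`, `F` transfer linearly to `ρ`, `ρ y`, `ρ / y`, vacuum
included. -/
lemma rho_eq {u : ℝ × ℝ} (h0 : 0 < ε) (hu : u ∈ phaseSpace ε) :
    (1 - ε ^ 2) * u.1 = G ε u - ε ^ 2 * F ε u := by
  rcases mem_interior_or_vacuum hu with h | h
  · have := (one_sub_sq_pos h0 h.2).ne'
    simp only [G, F]; field_simp; ring
  · simp [G, F, h]

lemma rho_boost_eq {u : ℝ × ℝ} (h0 : 0 < ε) (hu : u ∈ phaseSpace ε) :
    (1 + ε ^ 2) * (u.1 * boost ε u.2) = G ε u + 2 * ε * H ε u + ε ^ 2 * F ε u := by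
  rcases mem_interior_or_vacuum hu with h | h
  · obtain ⟨h1, h2⟩ := one_sub_pos_of_abs h0 h.2
    have h3 : 1 - ε ^ 2 * u.2 ^ 2 = (1 - ε * u.2) * (1 + ε * u.2) := by ring
    simp only [G, H, F, boost, h3]; field_simp; ring
  · simp [G, H, F, h]

lemma rho_div_boost_eq {u : ℝ × ℝ} (h0 : 0 < ε) (hu : u ∈ phaseSpace ε) :
    (1 + ε ^ 2) * (u.1 / boost ε u.2) = G ε u - 2 * ε * H ε u + ε ^ 2 * F ε u := by
  rcases mem_interior_or_vacuum hu with h | h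
  · obtain ⟨h1, h2⟩ := one_sub_pos_of_abs h0 h.2
    have h3 : 1 - ε ^ 2 * u.2 ^ 2 = (1 - ε * u.2) * (1 + ε * u.2) := by ring
    simp only [G, H, F, boost, h3]; field_simp; ring
  · simp [G, H, F, h]

lemma vel_mul_eq {u : ℝ × ℝ} (h0 : 0 < ε) (hu : u ∈ interiorStates ε) :
    H ε u = u.2 * (G ε u + ε ^ 2 * u.1) := by
  have := (one_sub_sq_pos h0 hu.2).ne'
  simp only [G, H]; field_simp; ring

lemma G_nonneg {u : ℝ × ℝ} (h0 : 0 < ε) (hu : u ∈ phaseSpace ε) : 0 ≤ G ε u := by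
  rcases mem_interior_or_vacuum hu with h | h
  · have := one_sub_sq_pos h0 h.2
    have := h.1
    simp only [G]; positivity
  · simp [G, h]

/-- The product of the null components is `ρ²`; eliminating `F` from it leaves a quadratic equation
whose nonnegative root is `rhoOf`. -/
lemma rho_quadratic {u : ℝ × ℝ} (h0 : 0 < ε) (hu : u ∈ phaseSpace ε) :
    ε ^ 2 * u.1 ^ 2 + (1 - ε ^ 2) * G ε u * u.1 = G ε u ^ 2 - ε ^ 2 * H ε u ^ 2 := by
  rcases mem_interior_or_vacuum hu with h | h
  · have := (one_sub_sq_pos h0 h.2).ne'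
    simp only [G, H]; field_simp; ring
  · simp [G, H, h]

lemma rhoOf_cons {u : ℝ × ℝ} (h0 : 0 < ε) (h1 : ε < 1) (hu : u ∈ phaseSpace ε) :
    rhoOf ε (cons ε u) = u.1 := by
  have h2 := rho_quadratic h0 hu
  have h3 := G_nonneg h0 hu
  have h4 : 0 ≤ 1 - ε ^ 2 := by nlinarith
  have h5 := hu.1
  have h6 : ((1 - ε ^ 2) * G ε u) ^ 2 + 4 * ε ^ 2 * (G ε u ^ 2 - ε ^ 2 * H ε u ^ 2) =
      (2 * ε ^ 2 * u.1 + (1 - ε ^ 2) * G ε u) ^ 2 := by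
    rw [← h2]; ring
  simp only [rhoOf, cons, h6]
  rw [Real.sqrt_sq (by positivity)]
  field_simp; ring

lemma nullOf_cons {u : ℝ × ℝ} (h0 : 0 < ε) (h1 : ε < 1) (hu : u ∈ phaseSpace ε) :
    nullOf ε (cons ε u) = nullState ε u := by
  have h2 := rhoOf_cons h0 h1 hu
  have h3 := rho_eq h0 hu
  have h4 := rho_boost_eq h0 hu
  have h5 := rho_div_boost_eq h0 hu
  have h6 : (1 + ε ^ 2) ≠ 0 := by positivity
  simp only [nullOf, nullState, h2]
  refine Prod.ext rfl (Prod.ext ?_ ?_)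
  · simp only [cons]; rw [div_eq_iff h6]; linarith
  · simp only [cons]; rw [div_eq_iff h6]; linarith

lemma continuous_nullOf (ε : ℝ) : Continuous (nullOf ε) := by
  have h : Continuous (rhoOf ε) := by unfold rhoOf; fun_prop
  unfold nullOf; fun_prop

lemma G_eq_null {u : ℝ × ℝ} (h0 : 0 < ε) (hu : u ∈ phaseSpace ε) :
    G ε u = ((1 + ε ^ 2) * (u.1 * boost ε u.2 + u.1 / boost ε u.2)
      + 2 * (1 - ε ^ 2) * u.1) / 4 := by
  linarith [rho_eq h0 hu, rho_boost_eq h0 hu, rho_div_boost_eq h0 hu]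

lemma H_eq_null {u : ℝ × ℝ} (h0 : 0 < ε) (hu : u ∈ phaseSpace ε) :
    ε * H ε u = (1 + ε ^ 2) * (u.1 * boost ε u.2 - u.1 / boost ε u.2) / 4 := by
  linarith [rho_boost_eq h0 hu, rho_div_boost_eq h0 hu]

lemma abs_H_le {u : ℝ × ℝ} (h0 : 0 < ε) (h1 : ε < 1) (hu : u ∈ phaseSpace ε) :
    ε * |H ε u| ≤ G ε u := by
  have h2 : 0 ≤ u.1 * boost ε u.2 ∧ 0 ≤ u.1 / boost ε u.2 := by
    rcases mem_interior_or_vacuum hu with h | h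
    · have := boost_pos h0 h.2; have := h.1; constructor <;> positivity
    · simp [h]
  have h3 : 0 ≤ 1 - ε ^ 2 := by nlinarith
  have h4 : |ε * H ε u| ≤ G ε u := by
    rw [H_eq_null h0 hu, G_eq_null h0 hu, abs_le]
    have h5 := mul_nonneg h3 hu.1
    have h6 : 0 ≤ (1 + ε ^ 2) * (u.1 * boost ε u.2) := mul_nonneg (by positivity) h2.1
    have h7 : 0 ≤ (1 + ε ^ 2) * (u.1 / boost ε u.2) := mul_nonneg (by positivity) h2.2
    constructor <;> linarith
  rwa [abs_mul, abs_of_pos h0] at h4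

/-- Every point of the cone `ε |H| < G` comes from a non-vacuum state. -/
lemma exists_cons_eq (h0 : 0 < ε) (h1 : ε < 1) {p : ℝ × ℝ} (hp : ε * |p.2| < p.1) :
    ∃ u ∈ interiorStates ε, cons ε u = p := by
  obtain ⟨g, q⟩ := p
  simp only at hp
  have hq : 0 ≤ ε * |q| := by positivity
  have hg : 0 < g := hq.trans_lt hp
  have h3 : 0 < 1 - ε ^ 2 := by nlinarith
  have h4 : 0 < g ^ 2 - ε ^ 2 * q ^ 2 := by
    rw [← sq_abs q]; nlinarith
  set ρ := rhoOf ε (g, q) with hρ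
  set D := ((1 - ε ^ 2) * g) ^ 2 + 4 * ε ^ 2 * (g ^ 2 - ε ^ 2 * q ^ 2) with hD
  have hD1 : ((1 - ε ^ 2) * g) ^ 2 < D := by
    have : 0 < 4 * ε ^ 2 * (g ^ 2 - ε ^ 2 * q ^ 2) := by positivity
    linarith
  have hs : (1 - ε ^ 2) * g < √D := Real.lt_sqrt_of_sq_lt hD1
  have hs2 : √D ^ 2 = D := Real.sq_sqrt ((sq_nonneg _).trans hD1.le)
  have hρ1 : 2 * ε ^ 2 * ρ = -((1 - ε ^ 2) * g) + √D := by
    exact mul_div_cancel₀ _ (by positivity)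
  have hρ0 : 0 < ρ := by
    have : 0 < 2 * ε ^ 2 * ρ := by rw [hρ1]; linarith
    exact pos_of_mul_pos_right this (by positivity)
  have hquad : ε ^ 2 * ρ ^ 2 + (1 - ε ^ 2) * g * ρ = g ^ 2 - ε ^ 2 * q ^ 2 := by
    have e1 : √D = 2 * ε ^ 2 * ρ + (1 - ε ^ 2) * g := by linarith
    rw [e1, hD] at hs2
    have : 4 * ε ^ 2 * (ε ^ 2 * ρ ^ 2 + (1 - ε ^ 2) * g * ρ - (g ^ 2 - ε ^ 2 * q ^ 2)) = 0 := by
      linear_combination hs2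
    have h5 : (4 * ε ^ 2) ≠ 0 := by positivity
    have := (mul_eq_zero.1 this).resolve_left h5
    linarith
  -- By `vel_mul_eq` the momentum is the velocity times `G + ε² ρ`, so the velocity has to be `q /
  -- K`.
  set K := g + ε ^ 2 * ρ with hK
  have hK0 : 0 < K := by positivity
  have hKg : g < K := by have : 0 < ε ^ 2 * ρ := by positivity
                         linarith
  have hKq : K ^ 2 - ε ^ 2 * q ^ 2 = (1 + ε ^ 2) * ρ * K := by
    rw [hK]; linear_combination -hquad
  refine ⟨(ρ, q / K), ⟨hρ0, ?_⟩, ?_⟩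
  · simp only [abs_div, abs_of_pos hK0]
    rw [← mul_div_assoc, div_lt_one hK0]
    linarith
  · have h6 : 1 - ε ^ 2 * (q / K) ^ 2 = (1 + ε ^ 2) * ρ / K := by
      rw [eq_div_iff hK0.ne']; field_simp; linear_combination hKq
    have h7 : (1 + ε ^ 2) ≠ 0 := by positivity
    refine Prod.ext ?_ ?_
    · simp only [cons, G, h6]
      field_simp
      have : g = K - ε ^ 2 * ρ := by rw [hK]; ring
      rw [this]
      linear_combination (-ε ^ 2) * hKq
    · simp only [cons, H, h6]
      field_simp

/-! ### Elementary inequalities governing shock curves. -/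

/-- Convexity of `sinh` on the half-line. It compares the Hugoniot curve with the level curve of the
Riemann invariant. -/
lemma sinh_mul_le {c a : ℝ} (hc0 : 0 ≤ c) (hc1 : c ≤ 1) (ha : 0 ≤ a) :
    Real.sinh (c * a) ≤ c * Real.sinh a := by
  have hd : ∀ x, HasDerivAt (fun x => c * Real.sinh x - Real.sinh (c * x))
      (c * Real.cosh x - Real.cosh (c * x) * (c * 1)) x := fun x =>
    ((Real.hasDerivAt_sinh x).const_mul c).sub (((hasDerivAt_id x).const_mul c).sinh)
  have hm := monotoneOn_of_deriv_nonneg (convex_Ici (0 : ℝ))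
    (fun x _ => (hd x).continuousAt.continuousWithinAt)
    (fun x _ => (hd x).differentiableAt.differentiableWithinAt) (by
      intro x hx
      rw [interior_Ici] at hx
      rw [(hd x).deriv]
      have : Real.cosh (c * x) ≤ Real.cosh x := by
        rw [Real.cosh_le_cosh, abs_mul, abs_of_nonneg hc0]
        exact mul_le_of_le_one_left (abs_nonneg _) hc1
      nlinarith)
  have := hm Set.self_mem_Ici ha ha
  simp at this
  exact this

/-- This is `d tanh a < tanh (d a)`, the strict concavity of `tanh`, cleared of denominators; the
difference has derivative `(1 - d²) sinh x sinh (d x)`. -/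
lemma mul_sinh_mul_cosh_lt {d a : ℝ} (hd0 : 0 < d) (hd1 : d < 1) (ha : 0 < a) :
    d * Real.sinh a * Real.cosh (d * a) < Real.sinh (d * a) * Real.cosh a := by
  have hd : ∀ x, HasDerivAt
      (fun x => Real.sinh (d * x) * Real.cosh x - d * Real.sinh x * Real.cosh (d * x))
      (Real.cosh (d * x) * (d * 1) * Real.cosh x + Real.sinh (d * x) * Real.sinh x -
        (d * Real.cosh x * Real.cosh (d * x) + d * Real.sinh x * (Real.sinh (d * x) * (d * 1))))
      x := fun x =>
    ((((hasDerivAt_id x).const_mul d).sinh).mul (Real.hasDerivAt_cosh x)).sub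
      (((Real.hasDerivAt_sinh x).const_mul d).mul (((hasDerivAt_id x).const_mul d).cosh))
  have hm := strictMonoOn_of_deriv_pos (convex_Ici (0 : ℝ))
    (fun x _ => (hd x).continuousAt.continuousWithinAt) (by
      intro x hx
      rw [interior_Ici] at hx
      rw [(hd x).deriv]
      have h1 : 0 < Real.sinh x := Real.sinh_pos_iff.2 hx
      have h2 : 0 < Real.sinh (d * x) := Real.sinh_pos_iff.2 (mul_pos hd0 hx)
      have h3 : 0 < (1 - d ^ 2) * (Real.sinh x * Real.sinh (d * x)) :=
        mul_pos (by nlinarith) (mul_pos h1 h2)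
      linarith)
  have := hm Set.self_mem_Ici ha.le ha
  simp at this
  exact this

/-- For `R = exp (2a)` one has `(R - 1)/(R + 1) = tanh a`, so comparing `R ^ d` with its Padé
quotient at `1` amounts to comparing `tanh (d a)` with `d tanh a`. The entropy inequality of a jump
turns out to be exactly such a comparison. -/
lemma pade_lt_rpow {d R : ℝ} (hd0 : 0 < d) (hd1 : d < 1) (hR : 1 < R) :
    (1 + d) * R + (1 - d) < R ^ d * ((1 - d) * R + (1 + d)) := by
  have hR0 : 0 < R := by linarith
  obtain ⟨a, rfl⟩ : ∃ a, R = Real.exp (2 * a) := ⟨Real.log R / 2, by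
    rw [mul_div_cancel₀ _ two_ne_zero, Real.exp_log hR0]⟩
  have ha : 0 < a := by
    have := Real.one_lt_exp_iff.1 hR
    linarith
  have h := mul_sinh_mul_cosh_lt hd0 hd1 ha
  rw [← Real.exp_mul]
  have e1 : Real.exp (2 * a * d) = Real.exp (d * a) * Real.exp (d * a) := by
    rw [← Real.exp_add]; ring_nf
  have e2 : Real.exp (2 * a) = Real.exp a * Real.exp a := by
    rw [← Real.exp_add]; ring_nf
  have e3 : Real.exp a * Real.exp (-a) = 1 := by rw [← Real.exp_add]; simp
  have e4 : Real.exp (d * a) * Real.exp (-(d * a)) = 1 := by rw [← Real.exp_add]; simp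
  rw [Real.sinh_eq, Real.sinh_eq, Real.cosh_eq, Real.cosh_eq] at h
  rw [e1, e2]
  have hA := Real.exp_pos a
  have hB := Real.exp_pos (d * a)
  generalize Real.exp a = A at *
  generalize Real.exp (d * a) = B at *
  generalize Real.exp (-a) = A' at *
  generalize Real.exp (-(d * a)) = B' at *
  have h2 := mul_lt_mul_of_pos_left h (mul_pos hA hB)
  have f1 : A * B * (d * ((A - A') / 2) * ((B + B') / 2)) =
      d / 4 * (A * A - A * A') * (B * B + B * B') := by ring
  have f2 : A * B * ((B - B') / 2 * ((A + A') / 2)) =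
      1 / 4 * (A * A + A * A') * (B * B - B * B') := by ring
  rw [f1, f2, e3, e4] at h2
  linarith

lemma rpow_lt_pade {d R : ℝ} (hd0 : 0 < d) (hd1 : d < 1) (hR0 : 0 < R) (hR : R < 1) :
    R ^ d * ((1 - d) * R + (1 + d)) < (1 + d) * R + (1 - d) := by
  have h := pade_lt_rpow hd0 hd1 ((one_lt_inv₀ hR0).2 hR)
  rw [Real.inv_rpow hR0.le] at h
  have h1 : 0 < R ^ d := Real.rpow_pos_of_pos hR0 d
  have h2 := mul_lt_mul_of_pos_left h (mul_pos h1 hR0)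
  have e1 : R ^ d * R * ((1 + d) * R⁻¹ + (1 - d)) = R ^ d * ((1 - d) * R + (1 + d)) := by
    field_simp; ring
  have e2 : R ^ d * R * ((R ^ d)⁻¹ * ((1 - d) * R⁻¹ + (1 + d))) = (1 + d) * R + (1 - d) := by
    field_simp; ring
  rwa [e1, e2] at h2

/-- With `R = exp (2a)` and `y = exp (-2b)` the Hugoniot relation reads `sinh b = c sinh a`, while
the conclusion reads `c a ≤ b`. -/
lemma rpow_mul_le_one_of_hugoniot {c R y : ℝ} (hc0 : 0 ≤ c) (hc1 : c ≤ 1) (hR : 1 ≤ R)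
    (hy0 : 0 < y) (hy1 : y ≤ 1) (h : (1 - y) ^ 2 * R = c ^ 2 * (R - 1) ^ 2 * y) :
    R ^ c * y ≤ 1 := by
  have hR0 : 0 < R := by linarith
  obtain ⟨a, rfl⟩ : ∃ a, R = Real.exp (2 * a) := ⟨Real.log R / 2, by
    rw [mul_div_cancel₀ _ two_ne_zero, Real.exp_log hR0]⟩
  obtain ⟨b, rfl⟩ : ∃ b, y = Real.exp (-(2 * b)) := ⟨-Real.log y / 2, by
    rw [mul_div_cancel₀ _ two_ne_zero, neg_neg, Real.exp_log hy0]⟩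
  have ha : 0 ≤ a := by
    have := Real.one_le_exp_iff.1 hR
    linarith
  have hb : 0 ≤ b := by
    have := Real.exp_le_one_iff.1 hy1
    linarith
  have e1 : Real.exp (2 * a) = Real.exp a * Real.exp a := by rw [← Real.exp_add]; ring_nf
  have e2 : Real.exp (-(2 * b)) = Real.exp (-b) * Real.exp (-b) := by
    rw [← Real.exp_add]; ring_nf
  have e3 : Real.exp a * Real.exp (-a) = 1 := by rw [← Real.exp_add]; simp
  have e4 : Real.exp b * Real.exp (-b) = 1 := by rw [← Real.exp_add]; simp
  have h3 : Real.sinh b ^ 2 = (c * Real.sinh a) ^ 2 := by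
    have f1 : 1 - Real.exp (-(2 * b)) = 2 * Real.exp (-b) * Real.sinh b := by
      rw [Real.sinh_eq, e2]; linear_combination -e4
    have f2 : Real.exp (2 * a) - 1 = 2 * Real.exp a * Real.sinh a := by
      rw [Real.sinh_eq, e1]; linear_combination e3
    rw [f1, f2, e1, e2] at h
    have f3 : (2 * Real.exp (-b) * Real.exp a) ^ 2 ≠ 0 := by positivity
    apply mul_left_cancel₀ f3
    linear_combination h
  have h4 : Real.sinh b = c * Real.sinh a :=
    (pow_left_inj₀ (Real.sinh_nonneg_iff.2 hb)
      (mul_nonneg hc0 (Real.sinh_nonneg_iff.2 ha)) two_ne_zero).1 h3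
  have h5 : c * a ≤ b := by
    rw [← Real.sinh_le_sinh, h4]
    exact sinh_mul_le hc0 hc1 ha
  rw [← Real.exp_mul, ← Real.exp_add, Real.exp_le_one_iff]
  linarith

/-! ### Admissible jumps: Lax condition and decrease of the Riemann invariant. -/

set_option maxHeartbeats 800000 in
/-- A nontrivial jump in ratio form: `R`, `y` are the quotients of the densities and of the boost
factors, `μ` the boost factor of the jump relative to the left state. -/
lemma lax_of_ratio {κ d c R y μ : ℝ} (hκ0 : 0 < κ) (hκ1 : κ < 1) (hd : d * (1 + κ ^ 2) = 2 * κ)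
    (hc : c * (1 + κ ^ 2) = 1 - κ ^ 2) (hR0 : 0 < R) (hy0 : 0 < y) (hμ : 0 < μ) (hR1 : R ≠ 1)
    (h1 : R * y - 1 = μ * d * (R - 1)) (h2 : d * (R - 1) = μ * (R / y - 1))
    (ent : μ * (R ^ (d / 2) * √(R / y) - 1) ≤ R ^ (d / 2) * √(R * y) - 1) :
    κ * μ < 1 ∧ R ^ c * y ≤ 1 := by
  have hκ2 : 0 < 1 + κ ^ 2 := by positivity
  have hd0 : 0 < d := pos_of_mul_pos_left (by rw [hd]; linarith) hκ2.le
  have hd1 : d < 1 := by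
    by_contra! h
    nlinarith [mul_le_mul_of_nonneg_right h hκ2.le, sq_nonneg (1 - κ), mul_pos (sub_pos.2 hκ1) (sub_pos.2 hκ1)]
  have hc0 : 0 ≤ c := (pos_of_mul_pos_left (by rw [hc]; nlinarith) hκ2.le).le
  have hcd : c ^ 2 = 1 - d ^ 2 := by
    have : (c ^ 2 - (1 - d ^ 2)) * (1 + κ ^ 2) ^ 2 = 0 := by
      linear_combination (c * (1 + κ ^ 2) + (1 - κ ^ 2)) * hc + (d * (1 + κ ^ 2) + 2 * κ) * hd
    have := (mul_eq_zero.1 this).resolve_right (by positivity)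
    linarith
  have hc1 : c ≤ 1 := by nlinarith
  have hd2 : 0 < 1 - d ^ 2 := by nlinarith
  have hrat : R / y * μ = μ + d * (R - 1) := by linear_combination -h2
  have hprod : R * y * (R / y * μ) = R ^ 2 * μ := by field_simp
  -- Eliminating `y` through `(R y)(R / y) = R²` and cancelling the trivial factor `R - 1`
  -- parametrizes the Hugoniot locus by `μ` alone.
  have hRμ : R * μ * (1 - d ^ 2) = (d * μ - 1) * (μ - d) := by
    have : (R - 1) * (R * μ * (1 - d ^ 2) - (d * μ - 1) * (μ - d)) = 0 := by
      rw [hrat] at hprod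
      linear_combination -hprod + (μ + d * (R - 1)) * h1
    have := (mul_eq_zero.1 this).resolve_left (sub_ne_zero.2 hR1)
    linarith
  have hq : (R - 1) * (μ * (1 - d ^ 2)) = d * μ ^ 2 - 2 * μ + d := by linear_combination hRμ
  have hRy : R * y * (1 - d ^ 2) = (d * μ - 1) ^ 2 := by
    linear_combination (1 - d ^ 2) * h1 + d * hq
  have hRy' : R / y * (μ ^ 2 * (1 - d ^ 2)) = (μ - d) ^ 2 := by
    linear_combination μ * (1 - d ^ 2) * hrat + d * hq
  have hquad : (d * μ ^ 2 - 2 * μ + d) * (1 + κ ^ 2) = 2 * ((κ * μ - 1) * (μ - κ)) := by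
    linear_combination (μ ^ 2 + 1) * hd
  set s := √(1 - d ^ 2) with hs
  have hs0 : 0 < s := Real.sqrt_pos.2 hd2
  have hs2 : s ^ 2 = 1 - d ^ 2 := Real.sq_sqrt hd2.le
  have hsq1 : √(R * y) = |d * μ - 1| / s := by
    have : R * y = (|d * μ - 1| / s) ^ 2 := by
      rw [div_pow, sq_abs, hs2, ← hRy, mul_div_cancel_right₀ _ hd2.ne']
    rw [this, Real.sqrt_sq (by positivity)]
  have hsq2 : √(R / y) = |μ - d| / (μ * s) := by
    have : R / y = (|μ - d| / (μ * s)) ^ 2 := by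
      rw [div_pow, sq_abs, mul_pow, hs2, ← hRy', mul_div_cancel_right₀ _ (by positivity)]
    rw [this, Real.sqrt_sq (by positivity)]
  set P := R ^ (d / 2) with hP
  have hP0 : 0 < P := Real.rpow_pos_of_pos hR0 _
  have hP2 : P ^ 2 = R ^ d := by
    rw [hP, ← Real.rpow_natCast, ← Real.rpow_mul hR0.le]; norm_num
  -- On the locus the Padé quotient of `R ^ d` equals `(1 + d)(μ - 1)² / ((1 - d)(1 + μ)²)`, which
  -- is what the squared entropy inequality compares with `R ^ d`.
  have hid : (1 - d) * (1 + μ) ^ 2 * ((1 + d) * R + (1 - d)) =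
      (1 + d) * (μ - 1) ^ 2 * ((1 - d) * R + (1 + d)) := by linear_combination 4 * hRμ
  have hE : 0 < (1 - d) * (1 + μ) ^ 2 := mul_pos (by linarith) (by positivity)
  have hden : 0 < (1 - d) * R + (1 + d) := by
    have := mul_pos (sub_pos.2 hd1) hR0
    linarith
  have hpos : 0 < (d * μ - 1) * (μ - d) := by rw [← hRμ]; positivity
  rw [hsq1, hsq2] at ent
  -- The two signs are the two families. In the first case `μ > 1`, and the entropy inequality
  -- forces `R < 1` (a 2-shock); in the second `μ < d`, and it forces `R > 1` (a 1-shock).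
  rcases pos_and_pos_or_neg_and_neg_of_mul_pos hpos with ⟨ha, hb⟩ | ⟨ha, hb⟩
  · rw [abs_of_pos ha, abs_of_pos hb] at ent
    have e1 : P * ((1 - d) * (1 + μ)) ≤ (μ - 1) * s := by
      have := mul_le_mul_of_nonneg_right ent hs0.le
      have f1 : μ * (P * ((μ - d) / (μ * s)) - 1) * s = P * (μ - d) - μ * s := by field_simp
      have f2 : (P * ((d * μ - 1) / s) - 1) * s = P * (d * μ - 1) - s := by field_simp
      rw [f1, f2] at this
      linarith
    have e2 : R ^ d * ((1 - d) * (1 + μ) ^ 2) ≤ (1 + d) * (μ - 1) ^ 2 := by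
      have h0 : 0 ≤ P * ((1 - d) * (1 + μ)) :=
        mul_nonneg hP0.le (mul_nonneg (by linarith) (by linarith))
      have := pow_le_pow_left₀ h0 e1 2
      rw [mul_pow P, mul_pow (1 - d), mul_pow (μ - 1), hP2, hs2] at this
      have h3 : 0 < 1 - d := by linarith
      refine le_of_mul_le_mul_left (a := 1 - d) ?_ h3
      linarith
    have e3 : R ^ d * ((1 - d) * R + (1 + d)) ≤ (1 + d) * R + (1 - d) := by
      refine le_of_mul_le_mul_left ?_ hE
      have := mul_le_mul_of_nonneg_right e2 hden.le
      rw [hid]; linarith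
    have hRlt : R < 1 := by
      refine lt_of_le_of_ne ?_ hR1
      by_contra! h
      exact absurd (pade_lt_rpow hd0 hd1 h) (not_lt.2 e3)
    have hneg : d * μ ^ 2 - 2 * μ + d < 0 := by
      rw [← hq]; exact mul_neg_of_neg_of_pos (by linarith) (by positivity)
    have hμ1 : κ < μ := by
      by_contra! h
      have := mul_le_mul_of_nonneg_left (h.trans hκ1.le) hd0.le
      linarith
    have hy : y * (μ - d) = μ * (d * μ - 1) := by
      have : (d * μ - 1) * (y * (μ - d) - μ * (d * μ - 1)) = 0 := by
        linear_combination (-y) * hRμ + μ * hRy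
      have := (mul_eq_zero.1 this).resolve_left ha.ne'
      linarith
    refine ⟨?_, ?_⟩
    · have h3 : (κ * μ - 1) * (μ - κ) < 0 := by
        have := mul_neg_of_neg_of_pos hneg hκ2
        rw [hquad] at this
        linarith
      by_contra! h4
      exact absurd h3 (not_lt.2 (mul_nonneg (by linarith) (by linarith)))
    · have hy1 : y ≤ 1 := by
        by_contra! h
        have := mul_lt_mul_of_pos_right h hb
        linarith
      exact mul_le_one₀ (Real.rpow_le_one hR0.le hRlt.le hc0) hy0.le hy1
  · rw [abs_of_neg ha, abs_of_neg hb] at ent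
    have hμ1 : μ < 1 := by linarith
    have e1 : (1 - μ) * s ≤ P * ((1 - d) * (1 + μ)) := by
      have := mul_le_mul_of_nonneg_right ent hs0.le
      have f1 : μ * (P * (-(μ - d) / (μ * s)) - 1) * s = -P * (μ - d) - μ * s := by
        field_simp
      have f2 : (P * (-(d * μ - 1) / s) - 1) * s = -P * (d * μ - 1) - s := by
        field_simp
      rw [f1, f2] at this
      linarith
    have e2 : (1 + d) * (μ - 1) ^ 2 ≤ R ^ d * ((1 - d) * (1 + μ) ^ 2) := by
      have h0 : 0 ≤ (1 - μ) * s := mul_nonneg (by linarith) hs0.le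
      have := pow_le_pow_left₀ h0 e1 2
      rw [mul_pow P, mul_pow (1 - d), mul_pow (1 - μ), hP2, hs2] at this
      have h3 : 0 < 1 - d := by linarith
      refine le_of_mul_le_mul_left (a := 1 - d) ?_ h3
      linarith
    have e3 : (1 + d) * R + (1 - d) ≤ R ^ d * ((1 - d) * R + (1 + d)) := by
      refine le_of_mul_le_mul_left ?_ hE
      have := mul_le_mul_of_nonneg_right e2 hden.le
      rw [hid]; linarith
    have hRgt : 1 < R := by
      refine lt_of_le_of_ne ?_ hR1.symm
      by_contra! h
      exact absurd (rpow_lt_pade hd0 hd1 hR0 h) (not_lt.2 e3)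
    have hqpos : 0 < d * μ ^ 2 - 2 * μ + d := by
      rw [← hq]; exact mul_pos (by linarith) (by positivity)
    have hy : y * (d - μ) = μ * (1 - d * μ) := by
      have : (d * μ - 1) * (y * (d - μ) - μ * (1 - d * μ)) = 0 := by
        linear_combination y * hRμ - μ * hRy
      have := (mul_eq_zero.1 this).resolve_left ha.ne
      linarith
    have hy1 : y ≤ 1 := by
      by_contra! h
      have := mul_lt_mul_of_pos_right h (neg_pos.2 hb)
      linarith
    refine ⟨mul_lt_one_of_nonneg_of_lt_one_left hκ0.le hκ1 hμ1.le, rpow_mul_le_one_of_hugoniot hc0 hc1 hRgt.le hy0 hy1 ?_⟩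
    have h3 : (R * y - 1) * (R / y - 1) = d ^ 2 * (R - 1) ^ 2 := by
      apply mul_left_cancel₀ hμ.ne'
      linear_combination μ * (R / y - 1) * h1 - μ * d * (R - 1) * h2
    have h4 : (R * y - 1) * (R / y - 1) * y = (R * y - 1) * (R - y) := by field_simp
    rw [h3] at h4
    rw [hcd]
    linear_combination h4

/-- Triples `(ρ, ρ y, ρ / y)` with `ρ ≥ 0` and `y > 0`, all entries being zero in the vacuum. -/
structure IsNullTriple (p : ℝ × ℝ × ℝ) : Prop where
  nonneg : 0 ≤ p.1
  mul_eq : p.2.1 * p.2.2 = p.1 ^ 2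
  pos : 0 < p.1 → 0 < p.2.1 ∧ 0 < p.2.2
  vacuum : p.1 = 0 → p.2.1 = 0 ∧ p.2.2 = 0

/-- The Rankine-Hugoniot relations in the null variables, with the entropy inequality of the
particle number. -/
structure IsNullJump (ε s : ℝ) (a b : ℝ × ℝ × ℝ) : Prop where
  left : IsNullTriple a
  right : IsNullTriple b
  rh₁ : (1 - ε * s) * (b.2.1 - a.2.1) = (1 + ε * s) * del ε * (b.1 - a.1)
  rh₂ : (1 - ε * s) * del ε * (b.1 - a.1) = (1 + ε * s) * (b.2.2 - a.2.2)
  entropy : (1 + ε * s) * (b.1 ^ (del ε / 2) * √b.2.2 - a.1 ^ (del ε / 2) * √a.2.2) ≤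
    (1 - ε * s) * (b.1 ^ (del ε / 2) * √b.2.1 - a.1 ^ (del ε / 2) * √a.2.1)

/-- Positive if and only if the second characteristic speed exceeds `ξ`. -/
def gap₂ (ε ξ : ℝ) (p : ℝ × ℝ × ℝ) : ℝ :=
  (1 - ε * ξ) * p.2.1 - kap ε * (1 + ε * ξ) * p.1

/-- Positive if and only if the first characteristic speed exceeds `ξ`. -/
def gap₁ (ε ξ : ℝ) (p : ℝ × ℝ × ℝ) : ℝ :=
  kap ε * (1 - ε * ξ) * p.2.1 - (1 + ε * ξ) * p.1

/-- The Riemann invariant that is constant across simple waves of the first family. -/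
def rinv (ε : ℝ) (p : ℝ × ℝ × ℝ) : ℝ := p.1 ^ (tameExponent ε - 1) * p.2.1

lemma kap_pos (h0 : 0 < ε) (h1 : ε < 1) : 0 < kap ε := div_pos (by linarith) (by linarith)

lemma kap_lt_one (h0 : 0 < ε) : kap ε < 1 := by
  rw [kap, div_lt_one (by linarith)]; linarith

lemma del_pos (h0 : 0 < ε) (h1 : ε < 1) : 0 < del ε := div_pos (by nlinarith) (by nlinarith)

lemma del_lt_one (h0 : 0 < ε) : del ε < 1 := by
  rw [del, div_lt_one (by positivity)]; nlinarith

lemma del_mul (h0 : 0 < ε) : del ε * (1 + kap ε ^ 2) = 2 * kap ε := by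
  have : 1 + ε ≠ 0 := by positivity
  have : 1 + ε ^ 2 ≠ 0 := by positivity
  simp only [del, kap]; field_simp; ring

lemma tameExponent_mul (h0 : 0 < ε) : tameExponent ε * (1 + kap ε ^ 2) = 1 - kap ε ^ 2 := by
  have : 1 + ε ≠ 0 := by positivity
  have : 1 + ε ^ 2 ≠ 0 := by positivity
  simp only [tameExponent, kap]; field_simp; ring

lemma tameExponent_pos (h0 : 0 < ε) : 0 < tameExponent ε := by
  unfold tameExponent; positivity

/-- The jump conditions do not connect the vacuum with other states. -/
lemma IsNullJump.fst_ne_zero {s : ℝ} {a b : ℝ × ℝ × ℝ} (h0 : 0 < ε)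
    (h : IsNullJump ε s a b) (hb : 0 < b.1) : 0 < a.1 := by
  refine h.left.nonneg.lt_of_ne' fun ha => ?_
  obtain ⟨ha1, ha2⟩ := h.left.vacuum ha
  obtain ⟨hb1, hb2⟩ := h.right.pos hb
  have e1 := h.rh₁
  have e2 := h.rh₂
  have e3 := h.right.mul_eq
  have hd := del_lt_one h0
  rw [ha, ha1, sub_zero, sub_zero] at e1
  rw [ha, ha2, sub_zero, sub_zero] at e2
  have hd1 : -1 < del ε := by
    rw [del, lt_div_iff₀ (by positivity)]; nlinarith
  have hd2 : 1 - del ε ^ 2 ≠ 0 := by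
    have : 0 < 1 - del ε ^ 2 := by nlinarith
    exact this.ne'
  -- With vacuum on the left, multiplying the two relations and using that the null components have
  -- product `ρ²` leaves only the two light speeds, and there one relation makes a null component
  -- vanish.
  have e4 : (1 - ε * s) * (1 + ε * s) * b.1 ^ 2 * (1 - del ε ^ 2) = 0 := by
    linear_combination (1 + ε * s) * b.2.2 * e1 - (1 - ε * s) * (1 + ε * s) * e3
      - (1 + ε * s) * del ε * b.1 * e2
  have e5 : (1 - ε * s) * (1 + ε * s) = 0 := by
    have := (mul_eq_zero.1 e4).resolve_right hd2
    exact (mul_eq_zero.1 this).resolve_right (by positivity)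
  rcases mul_eq_zero.1 e5 with h3 | h3
  · have h4 : 1 + ε * s = 2 := by linarith
    rw [h3, h4] at e2
    linarith
  · have h4 : 1 - ε * s = 2 := by linarith
    rw [h3, h4] at e1
    linarith

/-- Reflection `x ↦ -x`. -/
def mirror (p : ℝ × ℝ × ℝ) : ℝ × ℝ × ℝ := (p.1, p.2.2, p.2.1)

lemma IsNullTriple.mirror {p : ℝ × ℝ × ℝ} (h : IsNullTriple p) : IsNullTriple (mirror p) :=
  ⟨h.nonneg, (mul_comm _ _).trans h.mul_eq, fun hp => (h.pos hp).symm,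
    fun hp => (h.vacuum hp).symm⟩

lemma IsNullJump.mirror {s : ℝ} {a b : ℝ × ℝ × ℝ} (h : IsNullJump ε s a b) :
    IsNullJump ε (-s) (mirror b) (mirror a) := by
  refine ⟨h.right.mirror, h.left.mirror, ?_, ?_, ?_⟩
  · have := h.rh₂
    simp only [RelEuler.mirror]
    linear_combination this
  · have := h.rh₁
    simp only [RelEuler.mirror]
    linear_combination this
  · have := h.entropy
    simp only [RelEuler.mirror]
    linarith

lemma IsNullJump.snd_ne_zero {s : ℝ} {a b : ℝ × ℝ × ℝ} (h0 : 0 < ε)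
    (h : IsNullJump ε s a b) (ha : 0 < a.1) : 0 < b.1 :=
  IsNullJump.fst_ne_zero h0 (a := RelEuler.mirror b) (b := RelEuler.mirror a) h.mirror ha

/-- Nontrivial admissible jumps lower the Riemann invariant, and the second characteristic speed
on their left exceeds their speed. -/
lemma IsNullJump.lax {s : ℝ} {a b : ℝ × ℝ × ℝ} (h0 : 0 < ε) (h1 : ε < 1)
    (h : IsNullJump ε s a b) (ha : 0 < a.1) :
    a = b ∨ (0 < gap₂ ε s a ∧ rinv ε b ≤ rinv ε a) := by
  have hb := h.snd_ne_zero h0 ha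
  obtain ⟨ha1, ha2⟩ := h.left.pos ha
  obtain ⟨hb1, hb2⟩ := h.right.pos hb
  have e1 := h.rh₁
  have e2 := h.rh₂
  have e3 := h.left.mul_eq
  have e4 := h.right.mul_eq
  have ent := h.entropy
  obtain ⟨ra, za, ya⟩ := a
  obtain ⟨rb, zb, yb⟩ := b
  simp only at *
  have hd0 := del_pos h0 h1
  have hd1 := del_lt_one h0
  have hκ0 := kap_pos h0 h1
  have htriv : rb = ra → (zb = za ∨ yb = ya) → (ra, za, ya) = (rb, zb, yb) := by
    rintro rfl (rfl | rfl)
    · have : ya = yb := mul_left_cancel₀ hb1.ne' (e3.trans e4.symm)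
      rw [this]
    · have : za = zb := mul_right_cancel₀ hb2.ne' (e3.trans e4.symm)
      rw [this]
  by_cases hr : rb = ra
  · left
    rw [hr, sub_self, mul_zero] at e1
    rw [hr, sub_self, mul_zero] at e2
    by_cases hn : 1 - ε * s = 0
    · have : 1 + ε * s ≠ 0 := by intro h; linarith
      have := (mul_eq_zero.1 e2.symm).resolve_left this
      exact htriv hr (Or.inr (sub_eq_zero.1 this))
    · have := (mul_eq_zero.1 e1).resolve_left hn
      exact htriv hr (Or.inl (sub_eq_zero.1 this))
  · right
    have hr' : rb - ra ≠ 0 := sub_ne_zero.2 hr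
    set m := 1 - ε * s with hm
    set n := 1 + ε * s with hn
    have hmn : m + n = 2 := by rw [hm, hn]; ring
    have hm0 : m ≠ 0 := by
      intro h
      rw [h, zero_mul] at e1
      have : n ≠ 0 := by intro h; linarith
      exact mul_ne_zero (mul_ne_zero this hd0.ne') hr' e1.symm
    have hn0 : n ≠ 0 := by
      intro h
      rw [h, zero_mul] at e2
      exact mul_ne_zero (mul_ne_zero hm0 hd0.ne') hr' e2
    -- The speed is subluminal: otherwise both null components would change in the direction
    -- opposite to the density, although their product is its square.
    have hmnpos : 0 < m * n := by
      by_contra! hneg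
      have hneg : m * n < 0 := lt_of_le_of_ne hneg (mul_ne_zero hm0 hn0)
      have f1 : m * m * (zb - za) = m * n * del ε * (rb - ra) := by linear_combination m * e1
      have f2 : n * n * (yb - ya) = m * n * del ε * (rb - ra) := by linear_combination -n * e2
      have hmm : 0 < m * m := mul_self_pos.2 hm0
      have hnn : 0 < n * n := mul_self_pos.2 hn0
      have hc : m * n * del ε < 0 := mul_neg_of_neg_of_pos hneg hd0
      rcases lt_or_gt_of_ne hr with hlt | hgt
      · have g : 0 < m * n * del ε * (rb - ra) := mul_pos_of_neg_of_neg hc (by linarith)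
        have g1 : za < zb := by
          rw [← f1] at g
          linarith [pos_of_mul_pos_right g hmm.le]
        have g2 : ya < yb := by
          rw [← f2] at g
          linarith [pos_of_mul_pos_right g hnn.le]
        have := mul_lt_mul'' g1 g2 ha1.le ha2.le
        nlinarith
      · have g : m * n * del ε * (rb - ra) < 0 := mul_neg_of_neg_of_pos hc (by linarith)
        have g1 : zb < za := by
          rw [← f1] at g
          linarith [(pos_iff_neg_of_mul_neg g).1 hmm]
        have g2 : yb < ya := by
          rw [← f2] at g
          linarith [(pos_iff_neg_of_mul_neg g).1 hnn]
        have := mul_lt_mul'' g1 g2 hb1.le hb2.le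
        nlinarith
    obtain ⟨hmp, hnp⟩ : 0 < m ∧ 0 < n := by
      rcases pos_and_pos_or_neg_and_neg_of_mul_pos hmnpos with h | h
      · exact h
      · linarith
    have hya : ya = ra ^ 2 / za := by rw [eq_div_iff ha1.ne']; linarith
    have hyb : yb = rb ^ 2 / zb := by rw [eq_div_iff hb1.ne']; linarith
    have k1 : rb / ra * (zb * ra / (rb * za)) = zb / za := by field_simp
    have k2 : rb / ra / (zb * ra / (rb * za)) = yb / ya := by rw [hya, hyb]; field_simp
    have hpw : (rb / ra) ^ (del ε / 2) = rb ^ (del ε / 2) / ra ^ (del ε / 2) :=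
      Real.div_rpow hb.le ha.le _
    have hza : √ya * √za = ra := by
      rw [← Real.sqrt_mul ha2.le, mul_comm, e3, Real.sqrt_sq ha.le]
    have hsz : 0 < √za := Real.sqrt_pos.2 ha1
    have hsy : 0 < √ya := Real.sqrt_pos.2 ha2
    have hsz2 : √za ^ 2 = za := Real.sq_sqrt ha1.le
    have key := lax_of_ratio (κ := kap ε) (d := del ε) (c := tameExponent ε) (R := rb / ra)
      (y := zb * ra / (rb * za)) (μ := n * ra / (m * za)) hκ0 (kap_lt_one h0) (del_mul h0)
      (tameExponent_mul h0) (by positivity) (by positivity) (by positivity)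
      (by rw [Ne, div_eq_one_iff_eq ha.ne']; exact hr)
      (by
        rw [k1]; field_simp; linear_combination e1)
      (by
        rw [k2, hya]
        field_simp
        linear_combination za * e2 - n * e3)
      (by
        rw [k1, k2, hpw, Real.sqrt_div hb2.le, Real.sqrt_div hb1.le]
        have hp : 0 < ra ^ (del ε / 2) := Real.rpow_pos_of_pos ha _
        generalize ra ^ (del ε / 2) = pa at *
        generalize rb ^ (del ε / 2) = pb at *
        have hc : 0 < m * pa * √za := by positivity
        refine le_of_mul_le_mul_left ?_ hc
        have q1 : m * pa * √za * (n * ra / (m * za) * (pb / pa * (√yb / √ya) - 1)) =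
            n * (pb * √yb - pa * √ya) := by
          rw [← hza]
          nth_rw 3 [← hsz2]
          field_simp
        have q2 : m * pa * √za * (pb / pa * (√zb / √za) - 1) = m * (pb * √zb - pa * √za) := by
          field_simp
        rw [q1, q2]
        exact ent)
    obtain ⟨key1, key2⟩ := key
    constructor
    · simp only [gap₂]
      have : kap ε * (n * ra / (m * za)) * (m * za) < 1 * (m * za) :=
        mul_lt_mul_of_pos_right key1 (by positivity)
      have f : kap ε * (n * ra / (m * za)) * (m * za) = kap ε * n * ra := by field_simp
      rw [f] at this
      linarith
    · simp only [rinv]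
      rw [Real.div_rpow hb.le ha.le] at key2
      rw [Real.rpow_sub_one ha.ne', Real.rpow_sub_one hb.ne']
      have hp : 0 < ra ^ tameExponent ε := Real.rpow_pos_of_pos ha _
      generalize ra ^ tameExponent ε = pa at *
      generalize rb ^ tameExponent ε = pb at *
      have f : pb / rb * zb = (pb / pa * (zb * ra / (rb * za))) * (pa / ra * za) := by field_simp
      rw [f]
      exact mul_le_of_le_one_left (by positivity) key2

/-! ### The particle number as a concave function of the conservative variables. -/

/-- The particle number density. -/
def number (ε : ℝ) (u : ℝ × ℝ) : ℝ :=
  u.1 ^ (1 / (1 + ε ^ 2)) * (1 - ε ^ 2 * u.2 ^ 2) ^ (-(1 / 2) : ℝ)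

/-- Weighted AM–GM: the weights `(1 - d)/2`, `1/2`, `d/2` make all powers of `x` and `q` cancel in
the geometric mean. -/
lemma one_le_weighted {d x q : ℝ} (hd0 : 0 ≤ d) (hd1 : d ≤ 1) (hx : 0 < x) (hq : 0 < q) :
    1 ≤ (1 - d) / 2 * (x ^ ((1 + d) / 2) * q) + 1 / 2 * (x ^ ((1 + d) / 2 - 1) / q) +
      d / 2 * (x ^ ((1 + d) / 2 - 1) * q) := by
  have h := Real.geom_mean_le_arith_mean3_weighted (w₁ := (1 - d) / 2) (w₂ := 1 / 2)
    (w₃ := d / 2) (p₁ := x ^ ((1 + d) / 2) * q) (p₂ := x ^ ((1 + d) / 2 - 1) / q)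
    (p₃ := x ^ ((1 + d) / 2 - 1) * q) (by linarith) (by norm_num) (by linarith)
    (by positivity) (by positivity) (by positivity) (by ring)
  refine le_trans (le_of_eq ?_) h
  obtain ⟨a, rfl⟩ : ∃ a, x = Real.exp a := ⟨Real.log x, (Real.exp_log hx).symm⟩
  obtain ⟨b, rfl⟩ : ∃ b, q = Real.exp b := ⟨Real.log q, (Real.exp_log hq).symm⟩
  rw [← Real.exp_mul, ← Real.exp_mul, ← Real.exp_add, ← Real.exp_sub, ← Real.exp_add,
    ← Real.exp_mul, ← Real.exp_mul, ← Real.exp_mul, ← Real.exp_add, ← Real.exp_add,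
    eq_comm, Real.exp_eq_one_iff]
  ring

/-- Tangent inequality for the concave null components of the particle current. -/
lemma null_tangent {d ρ r g k : ℝ} (hd0 : 0 ≤ d) (hd1 : d ≤ 1) (hρ : 0 < ρ) (hr : 0 < r)
    (hg : 0 < g) (hk : 0 < k) :
    ρ ^ ((1 + d) / 2) * g ≤ (1 - d) / 2 * (r ^ ((1 + d) / 2) * k) +
      1 / 2 * r ^ ((1 + d) / 2 - 1) * ρ * (g ^ 2 / k + d * k) := by
  have h := one_le_weighted hd0 hd1 (div_pos hr hρ) (div_pos hk hg)
  rw [Real.div_rpow hr.le hρ.le, Real.div_rpow hr.le hρ.le, Real.rpow_sub_one hρ.ne'] at h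
  have hp : 0 < ρ ^ ((1 + d) / 2) := Real.rpow_pos_of_pos hρ _
  generalize r ^ ((1 + d) / 2) = a at *
  generalize ρ ^ ((1 + d) / 2) = b at *
  generalize r ^ ((1 + d) / 2 - 1) = c at *
  have h2 := mul_le_mul_of_nonneg_left h (mul_pos hp hg).le
  rw [mul_one] at h2
  refine h2.trans (le_of_eq ?_)
  field_simp
  ring

lemma one_add_del : (1 + del ε) / 2 = 1 / (1 + ε ^ 2) := by
  have : 1 + ε ^ 2 ≠ 0 := by positivity
  unfold del; field_simp; ring

lemma sq_rpow_neg_half {D : ℝ} (hD : 0 < D) : D ^ (-(1 / 2) : ℝ) = 1 / √D := by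
  rw [Real.rpow_neg hD.le, Real.sqrt_eq_rpow]; exact (one_div _).symm

lemma sqrt_boost {v : ℝ} (h0 : 0 < ε) (hv : ε * |v| < 1) :
    √(boost ε v) = (1 + ε * v) * (1 - ε ^ 2 * v ^ 2) ^ (-(1 / 2) : ℝ) ∧
    (√(boost ε v))⁻¹ = (1 - ε * v) * (1 - ε ^ 2 * v ^ 2) ^ (-(1 / 2) : ℝ) := by
  obtain ⟨h1, h2⟩ := one_sub_pos_of_abs h0 hv
  have hD := one_sub_sq_pos h0 hv
  have e : 1 - ε ^ 2 * v ^ 2 = (1 - ε * v) * (1 + ε * v) := by ring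
  rw [sq_rpow_neg_half hD, e, Real.sqrt_mul h1.le, boost, Real.sqrt_div h2.le]
  have s1 := Real.sqrt_pos.2 h1
  have s2 := Real.sqrt_pos.2 h2
  have t1 := Real.sq_sqrt h1.le
  have t2 := Real.sq_sqrt h2.le
  constructor
  · field_simp; exact t2
  · rw [inv_div]; field_simp; exact t1

lemma number_eq {u : ℝ × ℝ} (h0 : 0 < ε) (hu : u ∈ interiorStates ε) :
    number ε u =
      u.1 ^ ((1 + del ε) / 2) * (√(boost ε u.2) + (√(boost ε u.2))⁻¹) / 2 := by
  obtain ⟨h1, h2⟩ := sqrt_boost h0 hu.2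
  rw [h2, h1, one_add_del, number]; ring

/-- The differential of the particle number with respect to the conservative variables. -/
def numberDiff (ε : ℝ) (w : ℝ × ℝ) (p : ℝ × ℝ) : ℝ :=
  1 / (2 * (1 + ε ^ 2)) * w.1 ^ ((1 + del ε) / 2 - 1) *
    ((p.1 + ε * p.2) / √(boost ε w.2) + (p.1 - ε * p.2) * √(boost ε w.2))

lemma numberDiff_cons {u w : ℝ × ℝ} (h0 : 0 < ε) (hu : u ∈ interiorStates ε)
    (hw : w ∈ interiorStates ε) :
    numberDiff ε w (cons ε u) = 1 / 4 * w.1 ^ ((1 + del ε) / 2 - 1) * u.1 *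
      ((boost ε u.2 + del ε) / √(boost ε w.2) + ((boost ε u.2)⁻¹ + del ε) * √(boost ε w.2)) := by
  have h1 := G_eq_null h0 (interior_subset_phaseSpace hu)
  have h2 := H_eq_null h0 (interior_subset_phaseSpace hu)
  have hy := Real.sqrt_pos.2 (boost_pos h0 hw.2)
  have hyu := boost_pos h0 hu.2
  have : 1 + ε ^ 2 ≠ 0 := by positivity
  simp only [numberDiff, cons]
  rw [h1, h2, del]
  field_simp
  ring

/-- The tangent plane at `w` lies above the graph. The number density is half the sum of two null
terms, with `√y` and `1/√y`, and `null_tangent` bounds each. -/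
lemma number_tangent {u w : ℝ × ℝ} (h0 : 0 < ε) (h1 : ε < 1) (hu : u ∈ interiorStates ε)
    (hw : w ∈ interiorStates ε) :
    number ε u ≤ (1 - del ε) / 2 * number ε w + numberDiff ε w (cons ε u) := by
  have hd0 := (del_pos h0 h1).le
  have hd1 := (del_lt_one h0).le
  have hy := Real.sqrt_pos.2 (boost_pos h0 hu.2)
  have hyw := Real.sqrt_pos.2 (boost_pos h0 hw.2)
  have e1 := null_tangent hd0 hd1 hu.1 hw.1 hy hyw
  have e2 := null_tangent hd0 hd1 hu.1 hw.1 (inv_pos.2 hy) (inv_pos.2 hyw)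
  rw [numberDiff_cons h0 hu hw, number_eq h0 hu, number_eq h0 hw]
  rw [inv_pow, div_inv_eq_mul, Real.sq_sqrt (boost_pos h0 hu.2).le] at e2
  rw [Real.sq_sqrt (boost_pos h0 hu.2).le] at e1
  have := add_le_add e1 e2
  refine le_trans (le_of_eq ?_) ((div_le_div_of_nonneg_right this zero_le_two).trans (le_of_eq ?_))
  · ring
  · ring

/-- Euler's identity: the number density is homogeneous of degree `(1 + del ε) / 2` in `(G, H)`. It
shows that the plane of `number_tangent` touches the graph at `w`. -/
lemma numberDiff_self {w : ℝ × ℝ} (h0 : 0 < ε) (hw : w ∈ interiorStates ε) :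
    numberDiff ε w (cons ε w) = (1 + del ε) / 2 * number ε w := by
  have hyw := Real.sqrt_pos.2 (boost_pos h0 hw.2)
  have h2 := Real.sq_sqrt (boost_pos h0 hw.2).le
  have hw1 := hw.1
  rw [numberDiff_cons h0 hw hw, number_eq h0 hw, Real.rpow_sub_one hw1.ne']
  generalize √(boost ε w.2) = g at *
  rw [← h2]
  field_simp
  ring

/-- The particle number as a function of the conservative variables. -/
def numberOf (ε : ℝ) (p : ℝ × ℝ) : ℝ :=
  number ε (rhoOf ε p, p.2 / (p.1 + ε ^ 2 * rhoOf ε p))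

lemma numberOf_cons {u : ℝ × ℝ} (h0 : 0 < ε) (h1 : ε < 1) (hu : u ∈ interiorStates ε) :
    numberOf ε (cons ε u) = number ε u := by
  have hp := interior_subset_phaseSpace hu
  have h2 := vel_mul_eq h0 hu
  have h3 : G ε u + ε ^ 2 * u.1 ≠ 0 := by
    have := G_nonneg h0 hp
    have := hu.1
    positivity
  rw [numberOf, rhoOf_cons h0 h1 hp]
  simp only [cons]
  rw [h2, mul_div_cancel_right₀ _ h3]

lemma concaveOn_numberOf (h0 : 0 < ε) (h1 : ε < 1) :
    ConcaveOn ℝ {p : ℝ × ℝ | ε * |p.2| < p.1} (numberOf ε) := by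
  have hconv : Convex ℝ {p : ℝ × ℝ | ε * |p.2| < p.1} := by
    intro p hp q hq a b ha hb hab
    simp only [Set.mem_ofPred_eq, Prod.fst_add, Prod.snd_add, Prod.smul_fst, Prod.smul_snd,
      smul_eq_mul] at hp hq ⊢
    have h2 : |a * p.2 + b * q.2| ≤ a * |p.2| + b * |q.2| := by
      refine (abs_add_le _ _).trans (le_of_eq ?_)
      rw [abs_mul, abs_mul, abs_of_nonneg ha, abs_of_nonneg hb]
    have h3 := mul_le_mul_of_nonneg_left h2 h0.le
    rcases ha.eq_or_lt with rfl | ha'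
    · have : b = 1 := by linarith
      subst this
      linarith
    · have h4 := mul_lt_mul_of_pos_left hp ha'
      have h5 := mul_le_mul_of_nonneg_left hq.le hb
      linarith
  refine ⟨hconv, fun p hp q hq a b ha hb hab => ?_⟩
  obtain ⟨u, hu, rfl⟩ := exists_cons_eq h0 h1 hp
  obtain ⟨v, hv, rfl⟩ := exists_cons_eq h0 h1 hq
  -- The tangent plane at the convex combination itself is evaluated at both end points.
  obtain ⟨w, hw, hwe⟩ := exists_cons_eq h0 h1 (hconv hp hq ha hb hab)
  rw [← hwe, numberOf_cons h0 h1 hu, numberOf_cons h0 h1 hv, numberOf_cons h0 h1 hw,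
    smul_eq_mul, smul_eq_mul]
  have e1 := mul_le_mul_of_nonneg_left (number_tangent h0 h1 hu hw) ha
  have e2 := mul_le_mul_of_nonneg_left (number_tangent h0 h1 hv hw) hb
  have e3 := numberDiff_self h0 hw
  have e4 : numberDiff ε w (cons ε w) =
      a * numberDiff ε w (cons ε u) + b * numberDiff ε w (cons ε v) := by
    rw [hwe]
    simp only [numberDiff, Prod.fst_add, Prod.snd_add, Prod.smul_fst, Prod.smul_snd, smul_eq_mul]
    ring
  have e5 : b = 1 - a := by linarith
  subst e5
  linarith

lemma hasFDerivAt_number {u : ℝ × ℝ} (h0 : 0 < ε) (hu : u ∈ interiorStates ε) (d : ℝ × ℝ) :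
    DifferentiableAt ℝ (number ε) u ∧
    fderiv ℝ (number ε) u d = number ε u *
      (1 / ((1 + ε ^ 2) * u.1) * d.1 + ε ^ 2 * u.2 / (1 - ε ^ 2 * u.2 ^ 2) * d.2) := by
  have hD := one_sub_sq_pos h0 hu.2
  have hd1 : HasDerivAt (fun x : ℝ => x ^ (1 / (1 + ε ^ 2)))
      (1 / (1 + ε ^ 2) * u.1 ^ (1 / (1 + ε ^ 2) - 1)) u.1 :=
    Real.hasDerivAt_rpow_const (Or.inl hu.1.ne')
  have hd2 : HasDerivAt (fun v : ℝ => (1 - ε ^ 2 * v ^ 2) ^ (-(1 / 2) : ℝ))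
      (-(ε ^ 2 * (2 * u.2)) * (-(1 / 2)) * (1 - ε ^ 2 * u.2 ^ 2) ^ (-(1 / 2) - 1 : ℝ)) u.2 := by
    have : HasDerivAt (fun v : ℝ => 1 - ε ^ 2 * v ^ 2) (-(ε ^ 2 * (2 * u.2))) u.2 := by
      have := ((hasDerivAt_pow 2 u.2).const_mul (ε ^ 2)).const_sub 1
      simpa using this
    exact this.rpow_const (Or.inl hD.ne')
  have h := (hd1.hasFDerivAt.comp u hasFDerivAt_fst).mul
    (hd2.hasFDerivAt.comp u hasFDerivAt_snd)
  refine ⟨h.differentiableAt, ?_⟩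
  have h' := h.fderiv
  have e : (number ε) = ((fun x : ℝ => x ^ (1 / (1 + ε ^ 2))) ∘ Prod.fst) *
    ((fun v : ℝ => (1 - ε ^ 2 * v ^ 2) ^ (-(1 / 2) : ℝ)) ∘ Prod.snd) := rfl
  rw [e, h', Real.rpow_sub_one hu.1.ne', Real.rpow_sub_one hD.ne']
  simp
  field_simp
  ring

lemma tameRegion_cases {M : ℝ} (hM : 0 < M) {u : ℝ × ℝ} (hu : u ∈ tameRegion ε M) :
    u ∈ interiorStates ε ∨ u.1 = 0 := by
  rcases hu.1.eq_or_lt with h | h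
  · exact Or.inr h.symm
  · refine Or.inl ⟨h, ?_⟩
    have := Real.rpow_pos_of_pos (div_pos h hM) (tameExponent ε)
    linarith [hu.2.2]

lemma number_vacuum {u : ℝ × ℝ} (hu : u.1 = 0) : number ε u = 0 := by
  have : (1 / (1 + ε ^ 2)) ≠ 0 := by positivity
  rw [number, hu, Real.zero_rpow this, zero_mul]

lemma number_le {M : ℝ} (h0 : 0 < ε) (hM : 0 < M) {u : ℝ × ℝ} (hu : u ∈ tameRegion ε M)
    (hv : u ∈ interiorStates ε) :
    number ε u ≤ M ^ (1 / (1 + ε ^ 2)) *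
      (u.1 / M) ^ (1 / (1 + ε ^ 2) - tameExponent ε / 2) := by
  have hD := one_sub_sq_pos h0 hv.2
  have hx : 0 < u.1 / M := div_pos hv.1 hM
  have hp := Real.rpow_pos_of_pos hx (tameExponent ε)
  have h1 : (u.1 / M) ^ tameExponent ε ≤ 1 - ε ^ 2 * u.2 ^ 2 := by
    refine hu.2.2.trans ?_
    have h2 : 0 ≤ ε * |u.2| := by positivity
    have h3 : ε ^ 2 * u.2 ^ 2 = (ε * |u.2|) ^ 2 := by rw [mul_pow, sq_abs]
    rw [h3]
    nlinarith [hv.2]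
  have h2 : (1 - ε ^ 2 * u.2 ^ 2) ^ (-(1 / 2) : ℝ) ≤
      ((u.1 / M) ^ tameExponent ε) ^ (-(1 / 2) : ℝ) :=
    Real.rpow_le_rpow_of_nonpos hp h1 (by norm_num)
  have h3 : u.1 ^ (1 / (1 + ε ^ 2)) = M ^ (1 / (1 + ε ^ 2)) * (u.1 / M) ^ (1 / (1 + ε ^ 2)) := by
    rw [← Real.mul_rpow hM.le hx.le, mul_div_cancel₀ _ hM.ne']
  rw [number, h3, sub_eq_add_neg (1 / (1 + ε ^ 2)), Real.rpow_add hx, ← mul_assoc]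
  refine mul_le_mul_of_nonneg_left (h2.trans (le_of_eq ?_)) (by positivity)
  rw [← Real.rpow_mul hx.le]
  ring_nf

lemma number_nonneg {M : ℝ} (h0 : 0 < ε) (hM : 0 < M) {u : ℝ × ℝ} (hu : u ∈ tameRegion ε M) :
    0 ≤ number ε u := by
  rcases tameRegion_cases hM hu with h | h
  · have := one_sub_sq_pos h0 h.2
    have := h.1
    unfold number; positivity
  · rw [number_vacuum h]

lemma continuousAt_number {u : ℝ × ℝ} (h0 : 0 < ε) (hu : u ∈ interiorStates ε) :
    ContinuousAt (number ε) u :=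
  (hasFDerivAt_number h0 hu 0).1.continuousAt

/-- The issue is the vacuum, where the Lorentz factor may blow up. Tameness limits it to `(ρ /
M)^(-ε'/2)`, and the remaining exponent `1/(1 + ε²) - ε'/2 = (1 - ε)/(1 + ε²)` of the density is
positive. -/
lemma continuousOn_number {M : ℝ} (h0 : 0 < ε) (h1 : ε < 1) (hM : 0 < M) :
    ContinuousOn (number ε) (tameRegion ε M) := by
  intro u hu
  rcases tameRegion_cases hM hu with h | h
  · exact (continuousAt_number h0 h).continuousWithinAt
  · rw [ContinuousWithinAt, number_vacuum h]
    have hβ : 0 < 1 / (1 + ε ^ 2) - tameExponent ε / 2 := by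
      have : 1 / (1 + ε ^ 2) - tameExponent ε / 2 = (1 - ε) / (1 + ε ^ 2) := by
        unfold tameExponent; ring
      rw [this]
      exact div_pos (by linarith) (by positivity)
    set B : ℝ × ℝ → ℝ := fun w => M ^ (1 / (1 + ε ^ 2)) *
      (w.1 / M) ^ (1 / (1 + ε ^ 2) - tameExponent ε / 2) with hB
    have hBc : ContinuousAt B u := by
      refine continuousAt_const.mul (ContinuousAt.rpow_const ?_ (Or.inr hβ.le))
      exact (continuous_fst.div_const M).continuousAt
    have hB0 : B u = 0 := by
      simp only [hB, h, zero_div, Real.zero_rpow hβ.ne', mul_zero]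
    have hBt : Tendsto B (𝓝[tameRegion ε M] u) (𝓝 0) := by
      have := hBc.tendsto.mono_left (nhdsWithin_le_nhds (s := tameRegion ε M))
      rwa [hB0] at this
    refine tendsto_of_tendsto_of_tendsto_of_le_of_le' tendsto_const_nhds hBt ?_ ?_
    · filter_upwards [self_mem_nhdsWithin] with w hw using number_nonneg h0 hM hw
    · filter_upwards [self_mem_nhdsWithin] with w hw
      rcases tameRegion_cases hM hw with h' | h'
      · exact number_le h0 hM hw h'
      · rw [number_vacuum h']
        have := hw.1
        simp only [hB]
        positivity

lemma contDiffOn_number (h0 : 0 < ε) : ContDiffOn ℝ ∞ (number ε) (interiorStates ε) := by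
  unfold number
  refine ContDiffOn.mul ?_ ?_
  · exact contDiffOn_fst.rpow_const_of_ne fun u hu => hu.1.ne'
  · refine ContDiffOn.rpow_const_of_ne (by fun_prop) fun u hu => (one_sub_sq_pos h0 hu.2).ne'

/-- Minus the particle number, with the opposite of its current, is a convex weak entropy pair. -/
lemma isConvexWeakEntropyPair_number (h0 : 0 < ε) (h1 : ε < 1) :
    IsConvexWeakEntropyPair ε (fun u => -number ε u) (fun u => -(number ε u * u.2)) := by
  have hU : ∀ u ∈ interiorStates ε, ∀ d : ℝ × ℝ, fderiv ℝ (fun u => -number ε u) u d =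
      -(number ε u * (1 / ((1 + ε ^ 2) * u.1) * d.1 +
        ε ^ 2 * u.2 / (1 - ε ^ 2 * u.2 ^ 2) * d.2)) := by
    intro u hu d
    rw [fderiv_fun_neg, neg_apply, (hasFDerivAt_number h0 hu d).2]
  have hQ : ∀ u ∈ interiorStates ε, ∀ d : ℝ × ℝ,
      fderiv ℝ (fun u => -(number ε u * u.2)) u d =
      -(u.2 * (number ε u * (1 / ((1 + ε ^ 2) * u.1) * d.1 +
        ε ^ 2 * u.2 / (1 - ε ^ 2 * u.2 ^ 2) * d.2)) + number ε u * d.2) := by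
    intro u hu d
    obtain ⟨hd, he⟩ := hasFDerivAt_number h0 hu d
    rw [fderiv_fun_neg, neg_apply, fderiv_fun_mul hd differentiableAt_snd]
    simp [he, fderiv_snd]
    ring
  have hε2 : 1 + ε ^ 2 ≠ 0 := by positivity
  have hlam : ∀ u ∈ interiorStates ε, 0 < 1 - ε ^ 2 * u.2 ∧ 0 < 1 + ε ^ 2 * u.2 := by
    intro u hu
    have h2 : 0 < ε * (1 - ε * |u.2|) := mul_pos h0 (by linarith [hu.2])
    refine one_sub_pos_of_abs (by positivity) ?_
    linarith
  refine ⟨(contDiffOn_number h0).neg, ((contDiffOn_number h0).mul contDiffOn_snd).neg,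
    ?_, ?_, fun M hM => (continuousOn_number h0 h1 hM).neg,
    fun M hM => ((continuousOn_number h0 h1 hM).mul continuousOn_snd).neg, ?_, ?_⟩
  · intro u hu
    have := (one_sub_sq_pos h0 hu.2).ne'
    have := (hlam u hu).1.ne'
    have := hu.1.ne'
    rw [hU u hu, hQ u hu]
    simp only [r₁, lam₁]
    generalize hD : 1 - ε ^ 2 * u.2 ^ 2 = D at *
    generalize hE : 1 - ε ^ 2 * u.2 = E at *
    field_simp
    rw [← hD, ← hE]
    ring
  · intro u hu
    have := (one_sub_sq_pos h0 hu.2).ne'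
    have := (hlam u hu).2.ne'
    have := hu.1.ne'
    rw [hU u hu, hQ u hu]
    simp only [r₂, lam₂]
    generalize hD : 1 - ε ^ 2 * u.2 ^ 2 = D at *
    generalize hE : 1 + ε ^ 2 * u.2 = E at *
    field_simp
    rw [← hD, ← hE]
    ring
  · intro v _
    simp [number_vacuum (ε := ε) (u := (0, v)) rfl]
  · refine ⟨-numberOf ε, (concaveOn_numberOf h0 h1).neg, fun u hu => ?_⟩
    rw [Pi.neg_apply, numberOf_cons h0 h1 hu]

/-- The null components of the particle current. Each depends on the density and one null variable
only, which gives the entropy inequality its form in `IsNullJump`. -/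
lemma number_null {u : ℝ × ℝ} (h0 : 0 < ε) (hu : u ∈ phaseSpace ε) :
    number ε u * (1 + ε * u.2) =
      (nullState ε u).1 ^ (del ε / 2) * √(nullState ε u).2.1 ∧
    number ε u * (1 - ε * u.2) =
      (nullState ε u).1 ^ (del ε / 2) * √(nullState ε u).2.2 := by
  rcases mem_interior_or_vacuum hu with h | h
  · obtain ⟨h1, h2⟩ := sqrt_boost h0 h.2
    have h3 : u.1 ^ (del ε / 2) * √u.1 = u.1 ^ (1 / (1 + ε ^ 2)) := by
      rw [Real.sqrt_eq_rpow, ← Real.rpow_add h.1, ← one_add_del]; ring_nf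
    simp only [nullState]
    rw [div_eq_mul_inv u.1, Real.sqrt_mul hu.1, Real.sqrt_mul hu.1, Real.sqrt_inv, h2, h1, number, ← h3]
    constructor <;> ring
  · simp [number_vacuum h, nullState, h]

lemma isNullTriple_nullState {u : ℝ × ℝ} (h0 : 0 < ε) (hu : u ∈ phaseSpace ε) :
    IsNullTriple (nullState ε u) := by
  rcases mem_interior_or_vacuum hu with h | h
  · have hy := boost_pos h0 h.2
    have hρ := h.1
    refine ⟨hu.1, ?_, fun _ => ⟨?_, ?_⟩, fun h' => absurd h' h.1.ne'⟩ <;> simp only [nullState]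
    · field_simp
    · positivity
    · positivity
  · refine ⟨hu.1, ?_, fun h' => absurd h h'.ne', fun _ => ?_⟩ <;> simp [nullState, h]

lemma IsEntropyJump.isNullJump {s : ℝ} {a b : ℝ × ℝ} (h0 : 0 < ε) (h1 : ε < 1)
    (ha : a ∈ phaseSpace ε) (hb : b ∈ phaseSpace ε) (h : IsEntropyJump ε s a b) :
    IsNullJump ε s (nullState ε a) (nullState ε b) := by
  obtain ⟨hr1, hr2, hr3⟩ := h
  have hent := hr3 _ _ (isConvexWeakEntropyPair_number h0 h1)
  have a1 := rho_eq h0 ha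
  have a2 := rho_boost_eq h0 ha
  have a3 := rho_div_boost_eq h0 ha
  have b1 := rho_eq h0 hb
  have b2 := rho_boost_eq h0 hb
  have b3 := rho_div_boost_eq h0 hb
  have hε2 : 1 + ε ^ 2 ≠ 0 := by positivity
  refine ⟨isNullTriple_nullState h0 ha, isNullTriple_nullState h0 hb, ?_, ?_, ?_⟩
  · simp only [nullState, del]
    field_simp
    linear_combination (1 - ε * s) * (b2 - a2) - (1 + ε * s) * (b1 - a1) +
      2 * ε * hr1 + 2 * ε ^ 2 * hr2
  · simp only [nullState, del]
    field_simp
    linear_combination (1 - ε * s) * (b1 - a1) - (1 + ε * s) * (b3 - a3) +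
      2 * ε * hr1 - 2 * ε ^ 2 * hr2
  · rw [← (number_null h0 ha).1, ← (number_null h0 ha).2, ← (number_null h0 hb).1,
      ← (number_null h0 hb).2]
    have := mul_le_mul_of_nonneg_left hent (by positivity : 0 ≤ 2 * ε)
    linarith

/-! ### Self-similar profiles: smooth parts. -/

/-- Piecewise smooth self-similar entropy solutions in the null variables; `g` is the derivative of
the energy density. -/
structure IsProfile (ε : ℝ) (U : ℝ → ℝ × ℝ × ℝ) (g : ℝ → ℝ) (S : Finset ℝ) : Prop where
  triple : ∀ ξ, IsNullTriple (U ξ)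
  cont : ∀ ξ, ξ ∉ S → ContinuousAt g ξ
  deriv₁ : ∀ ξ, ξ ∉ S →
    HasDerivAt (fun η => (U η).1) ((1 + ε * ξ) * (1 - ε * ξ) * g ξ / (1 - ε ^ 2)) ξ
  deriv₂ : ∀ ξ, ξ ∉ S →
    HasDerivAt (fun η => (U η).2.1) ((1 + ε * ξ) ^ 2 * g ξ / (1 + ε ^ 2)) ξ
  deriv₃ : ∀ ξ, ξ ∉ S →
    HasDerivAt (fun η => (U η).2.2) ((1 - ε * ξ) ^ 2 * g ξ / (1 + ε ^ 2)) ξ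
  jump : ∀ s, ∃ a b, Tendsto U (𝓝[<] s) (𝓝 a) ∧ Tendsto U (𝓝[>] s) (𝓝 b) ∧
    (U s = a ∨ U s = b) ∧ IsNullJump ε s a b

lemma continuous_gap₁ : Continuous fun q : ℝ × (ℝ × ℝ × ℝ) => gap₁ ε q.1 q.2 := by
  unfold gap₁; fun_prop

lemma continuous_gap₂ : Continuous fun q : ℝ × (ℝ × ℝ × ℝ) => gap₂ ε q.1 q.2 := by
  unfold gap₂; fun_prop

lemma continuousAt_rinv {p : ℝ × ℝ × ℝ} (hp : p.1 ≠ 0) : ContinuousAt (rinv ε) p := by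
  unfold rinv
  exact (continuousAt_fst.rpow_const (Or.inl hp)).mul (by fun_prop)

/-- Strict hyperbolicity `λ₁ < λ₂`, in the form `kap · gap₂ - gap₁ = (1 - kap²)(1 + εξ) ρ`. -/
lemma gap₁_neg_of_gap₂_nonpos {ξ : ℝ} {p : ℝ × ℝ × ℝ} (h0 : 0 < ε) (h1 : ε < 1)
    (hp : IsNullTriple p) (hpos : 0 < p.1) (h : gap₂ ε ξ p ≤ 0) : gap₁ ε ξ p < 0 := by
  have hκ0 := kap_pos h0 h1
  have hκ1 := kap_lt_one h0
  obtain ⟨hz, -⟩ := hp.pos hpos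
  simp only [gap₁, gap₂] at *
  have hn : 0 < 1 + ε * ξ := by
    by_contra! hn
    have h2 : 0 < (1 - ε * ξ) * p.2.1 := mul_pos (by linarith) hz
    have h3 : kap ε * (1 + ε * ξ) * p.1 ≤ 0 :=
      mul_nonpos_of_nonpos_of_nonneg (mul_nonpos_of_nonneg_of_nonpos hκ0.le hn) hpos.le
    linarith
  have h4 := mul_le_mul_of_nonneg_left h hκ0.le
  have h5 : 0 < (1 - kap ε ^ 2) * ((1 + ε * ξ) * p.1) := mul_pos (by nlinarith) (mul_pos hn hpos)
  linarith

namespace IsProfile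

variable {U : ℝ → ℝ × ℝ × ℝ} {g : ℝ → ℝ} {S : Finset ℝ} {ξ : ℝ}

lemma continuousAt (h : IsProfile ε U g S) (hξ : ξ ∉ S) : ContinuousAt U ξ :=
  (h.deriv₁ ξ hξ).continuousAt.prodMk
    ((h.deriv₂ ξ hξ).continuousAt.prodMk (h.deriv₃ ξ hξ).continuousAt)

lemma eventually_notMem (S : Finset ℝ) (hξ : ξ ∉ S) : ∀ᶠ η in 𝓝 ξ, η ∉ S :=
  S.finite_toSet.isClosed.isOpen_compl.mem_nhds hξ

lemma eventually_notMem_punctured (S : Finset ℝ) (ξ : ℝ) : ∀ᶠ η in 𝓝[≠] ξ, η ∉ S := by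
  have h := eventually_notMem (S.erase ξ) (Finset.notMem_erase ξ S)
  filter_upwards [h.filter_mono nhdsWithin_le_nhds, self_mem_nhdsWithin] with η h1 h2 h3
  exact h1 (Finset.mem_erase.2 ⟨h2, h3⟩)

lemma hasDerivAt_gap₂ (h : IsProfile ε U g S) (hξ : ξ ∉ S) :
    HasDerivAt (fun η => gap₂ ε η (U η))
      (-ε * (U ξ).2.1 + (1 - ε * ξ) * ((1 + ε * ξ) ^ 2 * g ξ / (1 + ε ^ 2)) -
        (kap ε * ε * (U ξ).1 +
          kap ε * (1 + ε * ξ) * ((1 + ε * ξ) * (1 - ε * ξ) * g ξ / (1 - ε ^ 2)))) ξ := by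
  have e1 : HasDerivAt (fun η : ℝ => 1 - ε * η) (-ε) ξ := by
    simpa using ((hasDerivAt_id ξ).const_mul ε).const_sub 1
  have e2 : HasDerivAt (fun η : ℝ => kap ε * (1 + ε * η)) (kap ε * ε) ξ := by
    simpa using (((hasDerivAt_id ξ).const_mul ε).const_add 1).const_mul (kap ε)
  exact (e1.mul (h.deriv₂ ξ hξ)).sub (e2.mul (h.deriv₁ ξ hξ))

lemma hasDerivAt_gap₁ (h : IsProfile ε U g S) (hξ : ξ ∉ S) :
    HasDerivAt (fun η => gap₁ ε η (U η))
      (kap ε * -ε * (U ξ).2.1 + kap ε * (1 - ε * ξ) * ((1 + ε * ξ) ^ 2 * g ξ / (1 + ε ^ 2)) -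
        (ε * (U ξ).1 +
          (1 + ε * ξ) * ((1 + ε * ξ) * (1 - ε * ξ) * g ξ / (1 - ε ^ 2)))) ξ := by
  have e1 : HasDerivAt (fun η : ℝ => kap ε * (1 - ε * η)) (kap ε * -ε) ξ := by
    simpa using (((hasDerivAt_id ξ).const_mul ε).const_sub 1).const_mul (kap ε)
  have e2 : HasDerivAt (fun η : ℝ => 1 + ε * η) ε ξ := by
    simpa using ((hasDerivAt_id ξ).const_mul ε).const_add 1
  exact (e1.mul (h.deriv₂ ξ hξ)).sub (e2.mul (h.deriv₁ ξ hξ))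

/-- The factor `gap₁` exhibits the invariant as stationary in simple waves of the first family; in
those of the second the sign of `g` decides. -/
lemma hasDerivAt_rinv (h0 : 0 < ε) (h1 : ε < 1) (h : IsProfile ε U g S) (hξ : ξ ∉ S)
    (hpos : 0 < (U ξ).1) :
    HasDerivAt (fun η => rinv ε (U η))
      (-((U ξ).1 ^ (tameExponent ε - 2) * (1 + ε * ξ) / (1 + ε ^ 2)) *
        (g ξ * gap₁ ε ξ (U ξ))) ξ := by
  have hd := ((h.deriv₁ ξ hξ).rpow_const (p := tameExponent ε - 1) (Or.inl hpos.ne')).mul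
    (h.deriv₂ ξ hξ)
  refine hd.congr_deriv ?_
  have e : tameExponent ε - 1 = (tameExponent ε - 2) + 1 := by ring
  have e' : tameExponent ε - 1 - 1 = tameExponent ε - 2 := by ring
  rw [e', e, Real.rpow_add_one hpos.ne']
  have h2 : 1 - ε ^ 2 = (1 - ε) * (1 + ε) := by ring
  have h3 : 1 - ε ≠ 0 := by linarith
  have h4 : 1 + ε ≠ 0 := by positivity
  have h5 : 1 + ε ^ 2 ≠ 0 := by positivity
  generalize (U ξ).1 ^ (tameExponent ε - 2) = A
  rw [h2]
  simp only [gap₁, kap, tameExponent]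
  field_simp
  ring

/-- Differentiating the constraint that the null components have product `ρ²` gives a quadratic
condition that factors into the two gaps: the state varies only where `ξ` is a characteristic speed.
-/
lemma deriv_mul_gap (h0 : 0 < ε) (h1 : ε < 1) (h : IsProfile ε U g S) (hξ : ξ ∉ S)
    (hpos : 0 < (U ξ).1) : g ξ * (gap₂ ε ξ (U ξ) * gap₁ ε ξ (U ξ)) = 0 := by
  have hd1 := (h.deriv₂ ξ hξ).mul (h.deriv₃ ξ hξ)
  have hd2 := (h.deriv₁ ξ hξ).pow 2
  have he : (fun η => (U η).2.1) * (fun η => (U η).2.2) = (fun η => (U η).1) ^ 2 := by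
    funext η
    exact (h.triple η).mul_eq
  rw [he] at hd1
  have hu := hd1.unique hd2
  obtain ⟨hz, hy⟩ := (h.triple ξ).pos hpos
  have hm := (h.triple ξ).mul_eq
  have h2 : 1 - ε ^ 2 = (1 - ε) * (1 + ε) := by ring
  have h3 : 1 - ε ≠ 0 := by linarith
  have h4 : 1 + ε ≠ 0 := by positivity
  have h5 : 1 + ε ^ 2 ≠ 0 := by positivity
  rw [h2] at hu
  simp only [gap₁, gap₂, kap]
  simp only [Nat.cast_ofNat, Nat.add_one_sub_one, pow_one] at hu
  generalize (U ξ).1 = x at *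
  generalize (U ξ).2.1 = z at *
  generalize (U ξ).2.2 = y at *
  generalize 1 + ε * ξ = n at *
  generalize 1 - ε * ξ = m at *
  generalize g ξ = γ at *
  field_simp at hu ⊢
  linear_combination z * hu - (1 - ε ^ 2) * γ * n ^ 2 * hm

/-- Genuine nonlinearity: where `g` does not vanish, `gap₂` is zero on a whole neighbourhood, and
differentiating this identity determines the sign of `g`. -/
lemma deriv_pos_of_gap₂_eq_zero (h0 : 0 < ε) (h1 : ε < 1) (h : IsProfile ε U g S) (hξ : ξ ∉ S)
    (hpos : 0 < (U ξ).1) (hgap : gap₂ ε ξ (U ξ) = 0) (hg : g ξ ≠ 0) :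
    0 < g ξ ∧ 0 < 1 + ε * ξ ∧ 0 < 1 - ε * ξ := by
  have hκ0 := kap_pos h0 h1
  obtain ⟨hz, -⟩ := (h.triple ξ).pos hpos
  have hc := h.continuousAt hξ
  have hgap₁ := gap₁_neg_of_gap₂_nonpos h0 h1 (h.triple ξ) hpos hgap.le
  have c1 : ContinuousAt (fun η => gap₁ ε η (U η)) ξ := (h.hasDerivAt_gap₁ hξ).continuousAt
  have hev : ∀ᶠ η in 𝓝 ξ, gap₂ ε η (U η) = 0 := by
    filter_upwards [eventually_notMem S hξ, (h.cont ξ hξ).eventually_ne hg,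
      c1.eventually_lt_const hgap₁,
      (h.deriv₁ ξ hξ).continuousAt.eventually_const_lt hpos] with η e1 e2 e3 e4
    have := (mul_eq_zero.1 (h.deriv_mul_gap h0 h1 e1 e4)).resolve_left e2
    exact (mul_eq_zero.1 this).resolve_right e3.ne
  have hd : HasDerivAt (fun η => gap₂ ε η (U η)) 0 ξ :=
    (hasDerivAt_const ξ (0 : ℝ)).congr_of_eventuallyEq hev
  have hu := (h.hasDerivAt_gap₂ hξ).unique hd
  have hn : 0 < 1 + ε * ξ ∧ 0 < 1 - ε * ξ := by
    simp only [gap₂] at hgap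
    have e : (1 - ε * ξ) * (U ξ).2.1 = kap ε * (1 + ε * ξ) * (U ξ).1 := by linarith
    have hn1 : 0 < 1 + ε * ξ := by
      by_contra! hn
      have e1 : 0 < (1 - ε * ξ) * (U ξ).2.1 := mul_pos (by linarith) hz
      have e2 : kap ε * (1 + ε * ξ) * (U ξ).1 ≤ 0 :=
        mul_nonpos_of_nonpos_of_nonneg (mul_nonpos_of_nonneg_of_nonpos hκ0.le hn) hpos.le
      linarith
    refine ⟨hn1, ?_⟩
    have : 0 < (1 - ε * ξ) * (U ξ).2.1 := by rw [e]; positivity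
    exact pos_of_mul_pos_left this hz.le
  refine ⟨?_, hn⟩
  have h2 : 1 - ε ^ 2 = (1 - ε) * (1 + ε) := by ring
  have h3 : 0 < 1 - ε := by linarith
  have e : g ξ * ((1 + ε * ξ) ^ 2 * (1 - ε * ξ) * (2 * ε / ((1 + ε ^ 2) * (1 + ε) ^ 2))) =
      ε * ((U ξ).2.1 + kap ε * (U ξ).1) := by
    rw [h2] at hu
    have : g ξ * ((1 + ε * ξ) ^ 2 * (1 - ε * ξ) * (2 * ε / ((1 + ε ^ 2) * (1 + ε) ^ 2))) =
        (1 - ε * ξ) * ((1 + ε * ξ) ^ 2 * g ξ / (1 + ε ^ 2)) -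
        kap ε * (1 + ε * ξ) * ((1 + ε * ξ) * (1 - ε * ξ) * g ξ / ((1 - ε) * (1 + ε))) := by
      simp only [kap]
      generalize 1 + ε * ξ = n at *
      generalize 1 - ε * ξ = m at *
      field_simp
      ring
    rw [this]
    linarith
  have hr : 0 < ε * ((U ξ).2.1 + kap ε * (U ξ).1) := by positivity
  rw [← e] at hr
  obtain ⟨hn1, hn2⟩ := hn
  exact pos_of_mul_pos_left hr (by positivity)

/-- The same argument for the first family: now `gap₁` vanishes near `ξ`, and the sign of `g` is the
opposite one. -/
lemma deriv_neg_of_gap₂_pos (h0 : 0 < ε) (h1 : ε < 1) (h : IsProfile ε U g S) (hξ : ξ ∉ S)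
    (hpos : 0 < (U ξ).1) (hgap : 0 < gap₂ ε ξ (U ξ)) (hg : g ξ ≠ 0) :
    g ξ < 0 ∧ 0 < 1 + ε * ξ ∧ 0 < 1 - ε * ξ := by
  have hκ0 := kap_pos h0 h1
  obtain ⟨hz, -⟩ := (h.triple ξ).pos hpos
  have c2 : ContinuousAt (fun η => gap₂ ε η (U η)) ξ := (h.hasDerivAt_gap₂ hξ).continuousAt
  have hev : ∀ᶠ η in 𝓝 ξ, gap₁ ε η (U η) = 0 := by
    filter_upwards [eventually_notMem S hξ, (h.cont ξ hξ).eventually_ne hg,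
      c2.eventually_const_lt hgap,
      (h.deriv₁ ξ hξ).continuousAt.eventually_const_lt hpos] with η e1 e2 e3 e4
    have := (mul_eq_zero.1 (h.deriv_mul_gap h0 h1 e1 e4)).resolve_left e2
    exact (mul_eq_zero.1 this).resolve_left e3.ne'
  have hd : HasDerivAt (fun η => gap₁ ε η (U η)) 0 ξ :=
    (hasDerivAt_const ξ (0 : ℝ)).congr_of_eventuallyEq hev
  have hu := (h.hasDerivAt_gap₁ hξ).unique hd
  have hn : 0 < 1 + ε * ξ ∧ 0 < 1 - ε * ξ := by
    have hgap₁ := hev.self_of_nhds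
    simp only [gap₁] at hgap₁
    have e : kap ε * (1 - ε * ξ) * (U ξ).2.1 = (1 + ε * ξ) * (U ξ).1 := by linarith
    have hn1 : 0 < 1 + ε * ξ := by
      by_contra! hn
      have e1 : 0 < kap ε * (1 - ε * ξ) * (U ξ).2.1 :=
        mul_pos (mul_pos hκ0 (by linarith)) hz
      have e2 : (1 + ε * ξ) * (U ξ).1 ≤ 0 := mul_nonpos_of_nonpos_of_nonneg hn hpos.le
      linarith
    refine ⟨hn1, ?_⟩
    have : 0 < kap ε * (1 - ε * ξ) * (U ξ).2.1 := by rw [e]; positivity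
    exact pos_of_mul_pos_right (pos_of_mul_pos_left this hz.le) hκ0.le
  refine ⟨?_, hn⟩
  have h2 : 1 - ε ^ 2 = (1 - ε) * (1 + ε) := by ring
  have h3 : 0 < 1 - ε := by linarith
  have e : -g ξ * ((1 + ε * ξ) ^ 2 * (1 - ε * ξ) * (2 * ε / ((1 + ε ^ 2) * (1 - ε ^ 2)))) =
      ε * (kap ε * (U ξ).2.1 + (U ξ).1) := by
    rw [h2] at hu ⊢
    have : -g ξ * ((1 + ε * ξ) ^ 2 * (1 - ε * ξ) *
        (2 * ε / ((1 + ε ^ 2) * ((1 - ε) * (1 + ε))))) =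
        kap ε * (1 - ε * ξ) * ((1 + ε * ξ) ^ 2 * g ξ / (1 + ε ^ 2)) -
        (1 + ε * ξ) * ((1 + ε * ξ) * (1 - ε * ξ) * g ξ / ((1 - ε) * (1 + ε))) := by
      simp only [kap]
      generalize 1 + ε * ξ = n at *
      generalize 1 - ε * ξ = m at *
      field_simp
      ring
    rw [this]
    linarith
  have hr : 0 < ε * (kap ε * (U ξ).2.1 + (U ξ).1) := by positivity
  rw [← e] at hr
  obtain ⟨hn1, hn2⟩ := hn
  have hr' : 0 < -g ξ := pos_of_mul_pos_left hr (by rw [h2]; positivity)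
  linarith

/-- Below the second characteristic speed the density decreases and the Riemann invariant is
stationary. -/
lemma deriv_of_gap₂_pos (h0 : 0 < ε) (h1 : ε < 1) (h : IsProfile ε U g S) (hξ : ξ ∉ S)
    (hpos : 0 < (U ξ).1) (hgap : 0 < gap₂ ε ξ (U ξ)) :
    deriv (fun η => (U η).1) ξ ≤ 0 ∧ deriv (fun η => rinv ε (U η)) ξ = 0 := by
  rw [(h.deriv₁ ξ hξ).deriv, (h.hasDerivAt_rinv h0 h1 hξ hpos).deriv]
  have hm := h.deriv_mul_gap h0 h1 hξ hpos
  have hz : g ξ * gap₁ ε ξ (U ξ) = 0 := by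
    have : gap₂ ε ξ (U ξ) * (g ξ * gap₁ ε ξ (U ξ)) = 0 := by linarith
    exact (mul_eq_zero.1 this).resolve_left hgap.ne'
  refine ⟨?_, by rw [hz, mul_zero]⟩
  by_cases hg : g ξ = 0
  · simp [hg]
  · obtain ⟨e1, e2, e3⟩ := h.deriv_neg_of_gap₂_pos h0 h1 hξ hpos hgap hg
    exact div_nonpos_of_nonpos_of_nonneg
      (mul_nonpos_of_nonneg_of_nonpos (by positivity) e1.le) (by nlinarith)

/-- At and above the second characteristic speed the density and the Riemann invariant increase. -/
lemma deriv_of_gap₂_nonpos (h0 : 0 < ε) (h1 : ε < 1) (h : IsProfile ε U g S) (hξ : ξ ∉ S)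
    (hpos : 0 < (U ξ).1) (hgap : gap₂ ε ξ (U ξ) ≤ 0) :
    0 ≤ deriv (fun η => (U η).1) ξ ∧ 0 ≤ deriv (fun η => rinv ε (U η)) ξ := by
  rw [(h.deriv₁ ξ hξ).deriv, (h.hasDerivAt_rinv h0 h1 hξ hpos).deriv]
  have hm := h.deriv_mul_gap h0 h1 hξ hpos
  have hgap₁ := gap₁_neg_of_gap₂_nonpos h0 h1 (h.triple ξ) hpos hgap
  by_cases hg : g ξ = 0
  · simp [hg]
  · have hgap₂ : gap₂ ε ξ (U ξ) = 0 :=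
      (mul_eq_zero.1 ((mul_eq_zero.1 hm).resolve_left hg)).resolve_right hgap₁.ne
    obtain ⟨e1, e2, e3⟩ := h.deriv_pos_of_gap₂_eq_zero h0 h1 hξ hpos hgap₂ hg
    constructor
    · exact div_nonneg (by positivity) (by nlinarith)
    · rw [neg_mul, Left.nonneg_neg_iff]
      exact mul_nonpos_of_nonneg_of_nonpos (by positivity)
        (mul_nonpos_of_nonneg_of_nonpos e1.le hgap₁.le)

lemma mirror (h : IsProfile ε U g S) :
    IsProfile ε (fun ξ => mirror (U (-ξ))) (fun ξ => -g (-ξ)) (S.image Neg.neg) := by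
  have hS : ∀ ξ, ξ ∉ S.image Neg.neg → -ξ ∉ S := fun ξ hξ hm =>
    hξ (Finset.mem_image.2 ⟨-ξ, hm, neg_neg ξ⟩)
  refine ⟨fun ξ => (h.triple _).mirror, fun ξ hξ => ?_, fun ξ hξ => ?_, fun ξ hξ => ?_,
    fun ξ hξ => ?_, fun s => ?_⟩
  · have := h.cont _ (hS ξ hξ)
    exact (ContinuousAt.comp (f := Neg.neg) this continuousAt_neg).neg
  · refine ((h.deriv₁ _ (hS ξ hξ)).scomp ξ (hasDerivAt_neg ξ)).congr_deriv ?_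
    simp only [smul_eq_mul]; ring
  · refine ((h.deriv₃ _ (hS ξ hξ)).scomp ξ (hasDerivAt_neg ξ)).congr_deriv ?_
    simp only [smul_eq_mul]; ring
  · refine ((h.deriv₂ _ (hS ξ hξ)).scomp ξ (hasDerivAt_neg ξ)).congr_deriv ?_
    simp only [smul_eq_mul]; ring
  · obtain ⟨a, b, ha, hb, hs, hj⟩ := h.jump (-s)
    have hc : Continuous RelEuler.mirror := by unfold RelEuler.mirror; fun_prop
    have t1 : Tendsto Neg.neg (𝓝[<] s) (𝓝[>] (-s)) := tendsto_neg_nhdsLT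
    have t2 : Tendsto Neg.neg (𝓝[>] s) (𝓝[<] (-s)) := tendsto_neg_nhdsGT
    refine ⟨RelEuler.mirror b, RelEuler.mirror a, (hc.tendsto b).comp (hb.comp t1),
      (hc.tendsto a).comp (ha.comp t2), ?_, ?_⟩
    · rcases hs with hs | hs
      · exact Or.inr (congrArg _ hs)
      · exact Or.inl (congrArg _ hs)
    · simpa using hj.mirror

end IsProfile

/-! ### Propagation along a profile, across smooth parts and jumps. -/

/-- Continuous induction: the infimum of the points of failure satisfies `P` by `hl`, and then `hr`
pushes the failures away from it. -/
lemma forward_induction {P : ℝ → Prop} {a : ℝ} (ha : P a)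
    (hr : ∀ t, a ≤ t → P t → ∀ᶠ x in 𝓝[>] t, P x)
    (hl : ∀ t, a < t → (∀ x, a ≤ x → x < t → P x) → P t) : ∀ x, a ≤ x → P x := by
  by_contra! hcon
  obtain ⟨x₀, hx₀, hPx₀⟩ := hcon
  set B : Set ℝ := {x | a ≤ x ∧ ¬ P x} with hB
  have hne : B.Nonempty := ⟨x₀, hx₀, hPx₀⟩
  have hbd : BddBelow B := ⟨a, fun x hx => hx.1⟩
  have hat : a ≤ sInf B := le_csInf hne fun x hx => hx.1
  have hlt : ∀ x, a ≤ x → x < sInf B → P x := fun x hx hxt => by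
    by_contra hP
    exact absurd (csInf_le hbd ⟨hx, hP⟩) (not_le.2 hxt)
  have ht : P (sInf B) := by
    rcases hat.eq_or_lt with h | h
    · rwa [← h]
    · exact hl _ h hlt
  obtain ⟨d, hd, hsub⟩ := mem_nhdsGT_iff_exists_Ioo_subset.1 (hr _ hat ht)
  have : d ≤ sInf B := le_csInf hne fun x hx => by
    by_contra! hxd
    have hle := csInf_le hbd hx
    rcases hle.eq_or_lt with h | h
    · exact hx.2 (h ▸ ht)
    · exact hx.2 (hsub ⟨h, hxd⟩)
  exact absurd this (not_le.2 hd)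

lemma backward_induction {P : ℝ → Prop} {a : ℝ} (ha : P a)
    (hl : ∀ t, t ≤ a → P t → ∀ᶠ x in 𝓝[<] t, P x)
    (hr : ∀ t, t < a → (∀ x, t < x → x ≤ a → P x) → P t) : ∀ x, x ≤ a → P x := by
  have h := forward_induction (P := fun x => P (-x)) (a := -a) (by simpa using ha)
    (fun t ht hP => tendsto_neg_nhdsGT.eventually (hl (-t) (by linarith) hP))
    (fun t ht hP => hr (-t) (by linarith) fun x hx hxa => by
      simpa using hP (-x) (by linarith) (by linarith))
  intro x hx
  simpa using h (-x) (by linarith)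

lemma MonotoneOn.le_of_tendsto_left {f : ℝ → ℝ} {p q L : ℝ} (hf : MonotoneOn f (Set.Ioo p q))
    (hL : Tendsto f (𝓝[>] p) (𝓝 L)) : ∀ x ∈ Set.Ioo p q, L ≤ f x := fun x hx =>
  le_of_tendsto hL (by
    filter_upwards [Ioo_mem_nhdsGT hx.1] with y hy
    exact hf ⟨hy.1, hy.2.trans hx.2⟩ hx hy.2.le)

lemma AntitoneOn.ge_of_tendsto_left {f : ℝ → ℝ} {p q L : ℝ} (hf : AntitoneOn f (Set.Ioo p q))
    (hL : Tendsto f (𝓝[>] p) (𝓝 L)) : ∀ x ∈ Set.Ioo p q, f x ≤ L := fun x hx =>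
  ge_of_tendsto hL (by
    filter_upwards [Ioo_mem_nhdsGT hx.1] with y hy
    exact hf ⟨hy.1, hy.2.trans hx.2⟩ hx hy.2.le)

namespace IsProfile

variable {U : ℝ → ℝ × ℝ × ℝ} {g : ℝ → ℝ} {S : Finset ℝ} {p q : ℝ}

lemma monotoneOn_of_gap₂_nonpos (h0 : 0 < ε) (h1 : ε < 1) (h : IsProfile ε U g S)
    (hI : ∀ x ∈ Set.Ioo p q, x ∉ S ∧ 0 < (U x).1 ∧ gap₂ ε x (U x) ≤ 0) :
    MonotoneOn (fun x => (U x).1) (Set.Ioo p q) ∧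
    MonotoneOn (fun x => rinv ε (U x)) (Set.Ioo p q) := by
  constructor
  · refine monotoneOn_of_deriv_nonneg (convex_Ioo p q)
      (fun x hx => (h.deriv₁ x (hI x hx).1).continuousAt.continuousWithinAt) ?_ ?_ <;>
      rw [interior_Ioo]
    · exact fun x hx => (h.deriv₁ x (hI x hx).1).differentiableAt.differentiableWithinAt
    · exact fun x hx => (h.deriv_of_gap₂_nonpos h0 h1 (hI x hx).1 (hI x hx).2.1 (hI x hx).2.2).1
  · have hd : ∀ x ∈ Set.Ioo p q, DifferentiableAt ℝ (fun x => rinv ε (U x)) x := fun x hx =>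
      (h.hasDerivAt_rinv h0 h1 (hI x hx).1 (hI x hx).2.1).differentiableAt
    refine monotoneOn_of_deriv_nonneg (convex_Ioo p q)
      (fun x hx => (hd x hx).continuousAt.continuousWithinAt) ?_ ?_ <;> rw [interior_Ioo]
    · exact fun x hx => (hd x hx).differentiableWithinAt
    · exact fun x hx => (h.deriv_of_gap₂_nonpos h0 h1 (hI x hx).1 (hI x hx).2.1 (hI x hx).2.2).2

lemma antitoneOn_of_gap₂_pos (h0 : 0 < ε) (h1 : ε < 1) (h : IsProfile ε U g S)
    (hI : ∀ x ∈ Set.Ioo p q, x ∉ S ∧ 0 < (U x).1 ∧ 0 < gap₂ ε x (U x)) :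
    AntitoneOn (fun x => (U x).1) (Set.Ioo p q) ∧
    MonotoneOn (fun x => rinv ε (U x)) (Set.Ioo p q) ∧
    AntitoneOn (fun x => rinv ε (U x)) (Set.Ioo p q) := by
  have hd : ∀ x ∈ Set.Ioo p q, DifferentiableAt ℝ (fun x => rinv ε (U x)) x := fun x hx =>
    (h.hasDerivAt_rinv h0 h1 (hI x hx).1 (hI x hx).2.1).differentiableAt
  have h2 := fun x hx =>
    (h.deriv_of_gap₂_pos h0 h1 (hI x hx).1 (hI x hx).2.1 (hI x hx).2.2)
  refine ⟨?_, ?_, ?_⟩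
  · refine antitoneOn_of_deriv_nonpos (convex_Ioo p q)
      (fun x hx => (h.deriv₁ x (hI x hx).1).continuousAt.continuousWithinAt) ?_ ?_ <;>
      rw [interior_Ioo]
    · exact fun x hx => (h.deriv₁ x (hI x hx).1).differentiableAt.differentiableWithinAt
    · exact fun x hx => (h2 x hx).1
  · refine monotoneOn_of_deriv_nonneg (convex_Ioo p q)
      (fun x hx => (hd x hx).continuousAt.continuousWithinAt) ?_ ?_ <;> rw [interior_Ioo]
    · exact fun x hx => (hd x hx).differentiableWithinAt
    · exact fun x hx => (h2 x hx).2.ge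
  · refine antitoneOn_of_deriv_nonpos (convex_Ioo p q)
      (fun x hx => (hd x hx).continuousAt.continuousWithinAt) ?_ ?_ <;> rw [interior_Ioo]
    · exact fun x hx => (hd x hx).differentiableWithinAt
    · exact fun x hx => (h2 x hx).2.le

lemma eventually_right {t : ℝ} (S : Finset ℝ) : ∀ᶠ x in 𝓝[>] t, x ∉ S :=
  (eventually_notMem_punctured S t).filter_mono (nhdsWithin_mono t fun _ hx => ne_of_gt hx)

lemma eventually_left {t : ℝ} (S : Finset ℝ) : ∀ᶠ x in 𝓝[<] t, x ∉ S :=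
  (eventually_notMem_punctured S t).filter_mono (nhdsWithin_mono t fun _ hx => ne_of_lt hx)

lemma tendsto_gap₂ {t : ℝ} {s : Set ℝ} {b : ℝ × ℝ × ℝ} (hb : Tendsto U (𝓝[s] t) (𝓝 b)) :
    Tendsto (fun x => gap₂ ε x (U x)) (𝓝[s] t) (𝓝 (gap₂ ε t b)) := by
  have h1 : Tendsto (fun x : ℝ => x) (𝓝[s] t) (𝓝 t) := nhdsWithin_le_nhds
  have h2 := (continuous_gap₂ (ε := ε)).tendsto (t, b)
  exact h2.comp (f := fun x => (x, U x)) (h1.prodMk_nhds hb)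

lemma tendsto_gap₁ {t : ℝ} {s : Set ℝ} {b : ℝ × ℝ × ℝ} (hb : Tendsto U (𝓝[s] t) (𝓝 b)) :
    Tendsto (fun x => gap₁ ε x (U x)) (𝓝[s] t) (𝓝 (gap₁ ε t b)) := by
  have h1 : Tendsto (fun x : ℝ => x) (𝓝[s] t) (𝓝 t) := nhdsWithin_le_nhds
  have h2 := (continuous_gap₁ (ε := ε)).tendsto (t, b)
  exact h2.comp (f := fun x => (x, U x)) (h1.prodMk_nhds hb)

lemma tendsto_fst {l : Filter ℝ} {b : ℝ × ℝ × ℝ} (hb : Tendsto U l (𝓝 b)) :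
    Tendsto (fun x => (U x).1) l (𝓝 b.1) :=
  (continuous_fst.tendsto b).comp hb

lemma tendsto_rinv {l : Filter ℝ} {b : ℝ × ℝ × ℝ} (hb : Tendsto U l (𝓝 b)) (hpos : 0 < b.1) :
    Tendsto (fun x => rinv ε (U x)) l (𝓝 (rinv ε b)) :=
  (continuousAt_rinv hpos.ne').tendsto.comp hb

/-- Once the second characteristic speed has been reached, it stays reached. -/
lemma eventually_gap₂_nonpos (h0 : 0 < ε) (h1 : ε < 1) (h : IsProfile ε U g S) {t : ℝ}
    {b : ℝ × ℝ × ℝ} (hb : Tendsto U (𝓝[>] t) (𝓝 b)) (htr : IsNullTriple b) (hpos : 0 < b.1)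
    (hgap : gap₂ ε t b ≤ 0) :
    ∀ᶠ x in 𝓝[>] t, 0 < (U x).1 ∧ gap₂ ε x (U x) ≤ 0 ∧ b.1 ≤ (U x).1 ∧
      rinv ε b ≤ rinv ε (U x) := by
  have hev : ∀ᶠ x in 𝓝[>] t, x ∉ S ∧ 0 < (U x).1 ∧ gap₁ ε x (U x) < 0 :=
    (eventually_right S).and (((tendsto_fst hb).eventually_const_lt hpos).and
      ((tendsto_gap₁ hb).eventually_lt_const (gap₁_neg_of_gap₂_nonpos h0 h1 htr hpos hgap)))
  obtain ⟨d, hd, hsub⟩ := mem_nhdsGT_iff_exists_Ioo_subset.1 hev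
  have hκ0 := kap_pos h0 h1
  have hgap' : ∀ x ∈ Set.Ioo t d, gap₂ ε x (U x) ≤ 0 := by
    intro x hx
    refine le_of_forall_pos_le_add fun η hη => ?_
    rw [zero_add]
    obtain ⟨y, hy1, hy2⟩ := (((tendsto_gap₂ hb).eventually_lt_const
      (hgap.trans_lt hη)).and (Ioo_mem_nhdsGT hx.1)).exists
    have hIcc : ∀ z ∈ Set.Icc y x, z ∈ Set.Ioo t d := fun z hz =>
      ⟨hy2.1.trans_le hz.1, hz.2.trans_lt hx.2⟩
    -- The gap cannot rise through a level `η > 0`: there neither gap vanishes, so `g = 0`, and the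
    -- derivative of `gap₂` reduces to the negative term from the explicit dependence on `ξ`.
    refine image_le_of_deriv_right_lt_deriv_boundary (f := fun z => gap₂ ε z (U z))
      (a := y) (b := x) (B := fun _ => η) (B' := fun _ => 0)
      (fun z hz => (h.hasDerivAt_gap₂ (hsub (hIcc z hz)).1).continuousAt.continuousWithinAt)
      (fun z hz => (h.hasDerivAt_gap₂
        (hsub (hIcc z (Set.Ico_subset_Icc_self hz))).1).hasDerivWithinAt)
      hy1.le (fun z => hasDerivAt_const z η) ?_ ⟨hy2.2.le, le_rfl⟩
    intro z hz hzη
    obtain ⟨z1, z2, z3⟩ := hsub (hIcc z (Set.Ico_subset_Icc_self hz))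
    have hg : g z = 0 := by
      refine (mul_eq_zero.1 (h.deriv_mul_gap h0 h1 z1 z2)).resolve_right ?_
      exact mul_ne_zero (by rw [hzη]; exact hη.ne') z3.ne
    obtain ⟨hz1, -⟩ := (h.triple z).pos z2
    have e1 : 0 < ε * (U z).2.1 := by positivity
    have e2 : 0 < kap ε * ε * (U z).1 := by positivity
    simp only [hg, mul_zero, zero_div, add_zero]
    linarith
  obtain ⟨m1, m2⟩ := h.monotoneOn_of_gap₂_nonpos (p := t) (q := d) h0 h1 fun x hx =>
    ⟨(hsub hx).1, (hsub hx).2.1, hgap' x hx⟩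
  filter_upwards [Ioo_mem_nhdsGT hd] with x hx
  exact ⟨(hsub hx).2.1, hgap' x hx, MonotoneOn.le_of_tendsto_left m1 (tendsto_fst hb) x hx,
    MonotoneOn.le_of_tendsto_left m2 (tendsto_rinv hb hpos) x hx⟩

/-- To the right of the second characteristic speed there are no shocks, and the Riemann invariant
does not decrease. -/
lemma forward (h0 : 0 < ε) (h1 : ε < 1) (h : IsProfile ε U g S) {a : ℝ} (hpos : 0 < (U a).1)
    (hgap : gap₂ ε a (U a) ≤ 0) :
    ∀ x, a ≤ x → gap₂ ε x (U x) ≤ 0 ∧ (U a).1 ≤ (U x).1 ∧ rinv ε (U a) ≤ rinv ε (U x) := by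
  refine forward_induction ⟨hgap, le_rfl, le_rfl⟩ ?_ ?_
  · rintro t - ⟨e1, e2, e3⟩
    have hpt : 0 < (U t).1 := hpos.trans_le e2
    obtain ⟨l, b, hl, hb, hs, hj⟩ := h.jump t
    -- A nontrivial jump would need a positive `gap₂` on its left, so the value at `t` is the right
    -- limit whichever side it was taken from.
    have hUb : U t = b := by
      rcases hs with hs | hs
      · rcases hj.lax h0 h1 (by rwa [← hs]) with hlb | hlb
        · rw [hs, hlb]
        · rw [← hs] at hlb
          linarith [hlb.1]
      · exact hs
    rw [hUb] at hpt e1 e2 e3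
    filter_upwards [h.eventually_gap₂_nonpos h0 h1 hb hj.right hpt e1] with x hx
    exact ⟨hx.2.1, e2.trans hx.2.2.1, e3.trans hx.2.2.2⟩
  · intro t hat hP
    obtain ⟨l, b, hl, hb, hs, hj⟩ := h.jump t
    have hev : ∀ᶠ x in 𝓝[<] t, gap₂ ε x (U x) ≤ 0 ∧ (U a).1 ≤ (U x).1 ∧
        rinv ε (U a) ≤ rinv ε (U x) := by
      filter_upwards [Ioo_mem_nhdsLT hat] with x hx using hP x hx.1.le hx.2
    have l1 : gap₂ ε t l ≤ 0 := le_of_tendsto (tendsto_gap₂ hl) (hev.mono fun x hx => hx.1)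
    have l2 : (U a).1 ≤ l.1 := ge_of_tendsto (tendsto_fst hl) (hev.mono fun x hx => hx.2.1)
    have hpl : 0 < l.1 := hpos.trans_le l2
    have l3 : rinv ε (U a) ≤ rinv ε l :=
      ge_of_tendsto (tendsto_rinv hl hpl) (hev.mono fun x hx => hx.2.2)
    have hlb : l = b := (hj.lax h0 h1 hpl).resolve_right fun hlb => by linarith [hlb.1]
    have hUt : U t = l := by
      rcases hs with hs | hs
      · exact hs
      · rw [hs, hlb]
    rw [hUt]
    exact ⟨l1, l2, l3⟩

/-- To the left of the second characteristic speed the Riemann invariant does not increase. -/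
lemma backward (h0 : 0 < ε) (h1 : ε < 1) (h : IsProfile ε U g S) {a : ℝ} (hpos : 0 < (U a).1)
    (hgap : 0 < gap₂ ε a (U a)) :
    ∀ x, x ≤ a → 0 < (U x).1 ∧ 0 < gap₂ ε x (U x) ∧ rinv ε (U a) ≤ rinv ε (U x) := by
  have hleft : ∀ {t : ℝ} {l b : ℝ × ℝ × ℝ}, IsNullJump ε t l b → 0 < b.1 → 0 < gap₂ ε t b →
      0 < l.1 ∧ 0 < gap₂ ε t l ∧ rinv ε b ≤ rinv ε l := by
    intro t l b hj hb hg
    have hl := hj.fst_ne_zero h0 hb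
    rcases hj.lax h0 h1 hl with rfl | ⟨e1, e2⟩
    · exact ⟨hl, hg, le_rfl⟩
    · exact ⟨hl, e1, e2⟩
  refine backward_induction ⟨hpos, hgap, le_rfl⟩ ?_ ?_
  · rintro t - ⟨e1, e2, e3⟩
    obtain ⟨l, b, hl, hb, hs, hj⟩ := h.jump t
    obtain ⟨l1, l2, l3⟩ : 0 < l.1 ∧ 0 < gap₂ ε t l ∧ rinv ε (U a) ≤ rinv ε l := by
      rcases hs with hs | hs <;> rw [hs] at e1 e2 e3
      · exact ⟨e1, e2, e3⟩
      · obtain ⟨f1, f2, f3⟩ := hleft hj e1 e2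
        exact ⟨f1, f2, e3.trans f3⟩
    have hev : ∀ᶠ x in 𝓝[<] t, x ∉ S ∧ 0 < (U x).1 ∧ 0 < gap₂ ε x (U x) :=
      (eventually_left S).and (((tendsto_fst hl).eventually_const_lt l1).and
        ((tendsto_gap₂ hl).eventually_const_lt l2))
    obtain ⟨d, hd, hsub⟩ := mem_nhdsLT_iff_exists_Ioo_subset.1 hev
    obtain ⟨-, -, m3⟩ := h.antitoneOn_of_gap₂_pos (p := d) (q := t) h0 h1 fun x hx => hsub hx
    filter_upwards [Ioo_mem_nhdsLT hd] with x hx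
    refine ⟨(hsub hx).2.1, (hsub hx).2.2, l3.trans ?_⟩
    refine le_of_tendsto (tendsto_rinv hl l1) ?_
    filter_upwards [Ioo_mem_nhdsLT hx.2] with y hy
    exact m3 hx ⟨hx.1.trans hy.1, hy.2⟩ hy.1.le
  · intro t hta hP
    obtain ⟨l, b, hl, hb, hs, hj⟩ := h.jump t
    have hev : ∀ᶠ x in 𝓝[>] t, x ∉ S ∧ 0 < (U x).1 ∧ 0 < gap₂ ε x (U x) ∧
        rinv ε (U a) ≤ rinv ε (U x) := by
      refine (eventually_right S).and ?_
      filter_upwards [Ioo_mem_nhdsGT hta] with x hx using hP x hx.1 hx.2.le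
    obtain ⟨d, hd, hsub⟩ := mem_nhdsGT_iff_exists_Ioo_subset.1 hev
    obtain ⟨m1, -, m3⟩ := h.antitoneOn_of_gap₂_pos (p := t) (q := d) h0 h1 fun x hx =>
      ⟨(hsub hx).1, (hsub hx).2.1, (hsub hx).2.2.1⟩
    obtain ⟨x, hx⟩ := Set.nonempty_Ioo.2 (show t < d from hd)
    have b1 : 0 < b.1 := (hsub hx).2.1.trans_le
      (AntitoneOn.ge_of_tendsto_left m1 (tendsto_fst hb) x hx)
    have b3 : rinv ε (U a) ≤ rinv ε b := (hsub hx).2.2.2.trans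
      (AntitoneOn.ge_of_tendsto_left m3 (tendsto_rinv hb b1) x hx)
    -- If the right limit had reached the second characteristic speed, `eventually_gap₂_nonpos`
    -- would keep the gap nonpositive just to the right of `t`.
    have b2 : 0 < gap₂ ε t b := by
      by_contra! hneg
      obtain ⟨y, hy1, hy2⟩ := ((h.eventually_gap₂_nonpos h0 h1 hb hj.right b1 hneg).and hev).exists
      exact absurd hy1.2.1 (not_le.2 hy2.2.2.1)
    rcases hs with hs | hs <;> rw [hs]
    · obtain ⟨f1, f2, f3⟩ := hleft hj b1 b2
      exact ⟨f1, f2, b3.trans f3⟩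
    · exact ⟨b1, b2, b3⟩

/-- The Riemann invariant is bounded by its values near infinity. -/
lemma rinv_le (h0 : 0 < ε) (h1 : ε < 1) (h : IsProfile ε U g S) {a : ℝ} (hpos : 0 < (U a).1) :
    (∀ x, a ≤ x → 0 < (U x).1 ∧ rinv ε (U a) ≤ rinv ε (U x)) ∨
    (∀ x, x ≤ a → 0 < (U x).1 ∧ rinv ε (U a) ≤ rinv ε (U x)) := by
  rcases le_or_gt (gap₂ ε a (U a)) 0 with hg | hg
  · refine Or.inl fun x hx => ?_
    obtain ⟨-, e2, e3⟩ := h.forward h0 h1 hpos hg x hx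
    exact ⟨hpos.trans_le e2, e3⟩
  · refine Or.inr fun x hx => ?_
    obtain ⟨e1, -, e3⟩ := h.backward h0 h1 hpos hg x hx
    exact ⟨e1, e3⟩

end IsProfile

/-! ### Behaviour at infinity and comparison with the data. -/

namespace IsProfile

variable {U : ℝ → ℝ × ℝ × ℝ} {g : ℝ → ℝ} {S : Finset ℝ} {ξ : ℝ}

/-- Characteristic speeds are subluminal, so both gaps are nonzero here unless the density vanishes;
in the vacuum the density is at a minimum and its derivative is zero. -/
lemma deriv_eq_zero_of_light (h0 : 0 < ε) (h1 : ε < 1) (h : IsProfile ε U g S) (hξ : ξ ∉ S)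
    (hl : 1 < ε * |ξ|) : g ξ = 0 := by
  have hκ0 := kap_pos h0 h1
  have hn : (1 + ε * ξ) * (1 - ε * ξ) < 0 := by
    have : (1 + ε * ξ) * (1 - ε * ξ) = 1 - (ε * |ξ|) ^ 2 := by rw [mul_pow, sq_abs]; ring
    rw [this]
    nlinarith
  rcases (h.triple ξ).nonneg.eq_or_lt with hX | hX
  · have hmin : IsLocalMin (fun η => (U η).1) ξ := by
      filter_upwards with η
      rw [← hX]
      exact (h.triple η).nonneg
    have hz := hmin.hasDerivAt_eq_zero (h.deriv₁ ξ hξ)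
    have h2 : 1 - ε ^ 2 ≠ 0 := by
      have : 0 < 1 - ε ^ 2 := by nlinarith
      exact this.ne'
    exact (mul_eq_zero.1 ((div_eq_zero_iff.1 hz).resolve_right h2)).resolve_left hn.ne
  · obtain ⟨hz, -⟩ := (h.triple ξ).pos hX
    refine (mul_eq_zero.1 (h.deriv_mul_gap h0 h1 hξ hX)).resolve_right ?_
    rcases mul_neg_iff.1 hn with ⟨e1, e2⟩ | ⟨e1, e2⟩
    · refine mul_ne_zero (ne_of_lt ?_) (ne_of_lt ?_) <;> simp only [gap₁, gap₂]
      · have := mul_neg_of_neg_of_pos e2 hz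
        have : 0 < kap ε * (1 + ε * ξ) * (U ξ).1 := by positivity
        linarith
      · have := mul_neg_of_neg_of_pos (mul_neg_of_pos_of_neg hκ0 e2) hz
        have : 0 < (1 + ε * ξ) * (U ξ).1 := by positivity
        linarith
    · refine mul_ne_zero (ne_of_gt ?_) (ne_of_gt ?_) <;> simp only [gap₁, gap₂]
      · have := mul_neg_of_neg_of_pos (mul_neg_of_pos_of_neg hκ0 e1) hX
        have : 0 < (1 - ε * ξ) * (U ξ).2.1 := by positivity
        linarith
      · have := mul_neg_of_neg_of_pos e1 hX
        have : 0 < kap ε * (1 - ε * ξ) * (U ξ).2.1 := by positivity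
        linarith

lemma fst_const (h0 : 0 < ε) (h1 : ε < 1) (h : IsProfile ε U g S) {D : Set ℝ} (hD : IsOpen D)
    (hc : IsPreconnected D) (hDS : ∀ x ∈ D, x ∉ S ∧ 1 < ε * |x|) :
    ∀ x ∈ D, ∀ y ∈ D, (U x).1 = (U y).1 := by
  intro x hx y hy
  refine hD.is_const_of_deriv_eq_zero hc
    (fun z hz => (h.deriv₁ z (hDS z hz).1).differentiableAt.differentiableWithinAt)
    (fun z hz => ?_) hx hy
  rw [(h.deriv₁ z (hDS z hz).1).deriv,
    h.deriv_eq_zero_of_light h0 h1 (hDS z hz).1 (hDS z hz).2]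
  simp

/-- Continuity of `rinv` is available only off the vacuum. Constancy of the density near infinity
keeps the limit state away from it. -/
lemma limit_rinv {l : Filter ℝ} [l.NeBot] {b : ℝ × ℝ × ℝ} {D : Set ℝ} {w : ℝ}
    (hb : Tendsto U l (𝓝 b)) (hD : D ∈ l) (hconst : ∀ x ∈ D, ∀ y ∈ D, (U x).1 = (U y).1)
    (hw : ∀ᶠ x in l, 0 < (U x).1 ∧ w ≤ rinv ε (U x)) : 0 < b.1 ∧ w ≤ rinv ε b := by
  obtain ⟨x, hx, hxD⟩ := (hw.and hD).exists
  have hbx : b.1 = (U x).1 := by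
    refine tendsto_nhds_unique (tendsto_fst hb) (tendsto_const_nhds.congr' ?_)
    filter_upwards [hD] with y hy using hconst x hxD y hy
  have hpos : 0 < b.1 := by rw [hbx]; exact hx.1
  exact ⟨hpos, ge_of_tendsto (tendsto_rinv hb hpos) (hw.mono fun y hy => hy.2)⟩

lemma exists_bound (S : Finset ℝ) (h0 : 0 < ε) :
    ∃ A, ∀ x, A < |x| → x ∉ S ∧ 1 < ε * |x| := by
  obtain ⟨B, hB⟩ := (S.image abs).bddAbove
  refine ⟨max B (1 / ε), fun x hx => ⟨fun hxS => ?_, ?_⟩⟩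
  · have := hB (Finset.mem_coe.2 (Finset.mem_image_of_mem abs hxS))
    exact absurd ((le_max_left B _).trans_lt hx) (not_lt.2 this)
  · have := (le_max_right B (1 / ε)).trans_lt hx
    rw [div_lt_iff₀ h0] at this
    linarith

/-- The Riemann invariant of a self-similar solution is bounded by those of its data. -/
lemma rinv_le_data (h0 : 0 < ε) (h1 : ε < 1) (h : IsProfile ε U g S) {a b : ℝ × ℝ × ℝ}
    (ha : Tendsto U atBot (𝓝 a)) (hb : Tendsto U atTop (𝓝 b)) (hpos : 0 < (U ξ).1) :
    (0 < a.1 ∧ rinv ε (U ξ) ≤ rinv ε a) ∨ (0 < b.1 ∧ rinv ε (U ξ) ≤ rinv ε b) := by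
  obtain ⟨A, hA⟩ := exists_bound S h0
  rcases h.rinv_le h0 h1 hpos with hr | hl
  · refine Or.inr (limit_rinv hb (Ioi_mem_atTop (max A 0)) ?_ ?_)
    · refine h.fst_const h0 h1 isOpen_Ioi isPreconnected_Ioi fun x hx => hA x ?_
      exact (le_max_left A 0).trans_lt (lt_of_lt_of_le hx (le_abs_self x))
    · filter_upwards [Ici_mem_atTop ξ] with x hx using hr x hx
  · refine Or.inl (limit_rinv ha (Iio_mem_atBot (min (-A) 0)) ?_ ?_)
    · refine h.fst_const h0 h1 isOpen_Iio isPreconnected_Iio fun x hx => hA x ?_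
      have h2 : x < min (-A) 0 := hx
      have := h2.trans_le (min_le_left _ _)
      exact lt_of_lt_of_le (by linarith) (neg_le_abs x)
    · filter_upwards [Iic_mem_atBot ξ] with x hx using hl x hx

end IsProfile

/-- The velocity need not converge at the vacuum, but the null variables are continuous functions of
the conservative ones. -/
lemma tendsto_nullState {r : ℝ → ℝ × ℝ} (h0 : 0 < ε) (h1 : ε < 1) (hr : ∀ ξ, r ξ ∈ phaseSpace ε)
    {l : Filter ℝ} {a : ℝ × ℝ} (ha : a ∈ phaseSpace ε)
    (h : Tendsto (fun ξ => cons ε (r ξ)) l (𝓝 (cons ε a))) :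
    Tendsto (fun ξ => nullState ε (r ξ)) l (𝓝 (nullState ε a)) := by
  have := ((continuous_nullOf ε).tendsto (cons ε a)).comp h
  rw [nullOf_cons h0 h1 ha] at this
  refine this.congr fun ξ => ?_
  exact nullOf_cons h0 h1 (hr ξ)

/-- With `g = G'` the equations give `H' = ξ g` and `F' = ξ² g`, so the derivatives of the null
variables are `g` times products of `1 ± εξ`. Points outside the exceptional set carry the trivial
jump. -/
lemma IsRiemannSolution.exists_isProfile {ul ur : ℝ × ℝ} {r : ℝ → ℝ × ℝ} (h0 : 0 < ε)
    (h1 : ε < 1) (h : IsRiemannSolution ε ul ur r) :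
    ∃ g S, IsProfile ε (fun ξ => nullState ε (r ξ)) g S := by
  obtain ⟨S, hS, hJ⟩ := h.piecewise
  have hε : 1 - ε ^ 2 ≠ 0 := by
    have : 0 < 1 - ε ^ 2 := by nlinarith
    exact this.ne'
  have hε2 : 1 + ε ^ 2 ≠ 0 := by positivity
  have hd : ∀ ξ, ξ ∉ S →
      HasDerivAt (fun η => G ε (r η)) (deriv (fun η => G ε (r η)) ξ) ξ ∧
      HasDerivAt (fun η => H ε (r η)) (ξ * deriv (fun η => G ε (r η)) ξ) ξ ∧
      HasDerivAt (fun η => F ε (r η)) (ξ * (ξ * deriv (fun η => G ε (r η)) ξ)) ξ := by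
    intro ξ hξ
    obtain ⟨e1, e2, e3⟩ := hS ξ hξ
    refine ⟨?_, e2, by rwa [e2.deriv] at e3⟩
    exact ((e1.differentiableAt one_ne_zero).fst).hasDerivAt
  refine ⟨deriv (fun η => G ε (r η)), S,
    fun ξ => isNullTriple_nullState h0 (h.mem_phaseSpace ξ), ?_, ?_, ?_, ?_, ?_⟩
  · intro ξ hξ
    have e1 : ContDiffAt ℝ 1 (fun η => G ε (r η)) ξ := (hS ξ hξ).1.fst
    have e2 : ContinuousAt (fderiv ℝ fun η => G ε (r η)) ξ :=
      (e1.fderiv_right (m := 0) (by norm_num)).continuousAt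
    exact e2.clm_apply continuousAt_const
  · intro ξ hξ
    obtain ⟨e1, e2, e3⟩ := hd ξ hξ
    have := (e1.sub (e3.const_mul (ε ^ 2))).div_const (1 - ε ^ 2)
    refine (this.congr_of_eventuallyEq (Eventually.of_forall fun η => ?_)).congr_deriv ?_
    · have := rho_eq h0 (h.mem_phaseSpace η)
      simp only [nullState, Pi.sub_apply]
      rw [eq_div_iff hε]; linarith
    · ring
  · intro ξ hξ
    obtain ⟨e1, e2, e3⟩ := hd ξ hξ
    have := ((e1.add (e2.const_mul (2 * ε))).add (e3.const_mul (ε ^ 2))).div_const (1 + ε ^ 2)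
    refine (this.congr_of_eventuallyEq (Eventually.of_forall fun η => ?_)).congr_deriv ?_
    · have := rho_boost_eq h0 (h.mem_phaseSpace η)
      simp only [nullState, Pi.add_apply]
      rw [eq_div_iff hε2]; linarith
    · ring
  · intro ξ hξ
    obtain ⟨e1, e2, e3⟩ := hd ξ hξ
    have := ((e1.sub (e2.const_mul (2 * ε))).add (e3.const_mul (ε ^ 2))).div_const (1 + ε ^ 2)
    refine (this.congr_of_eventuallyEq (Eventually.of_forall fun η => ?_)).congr_deriv ?_
    · have := rho_div_boost_eq h0 (h.mem_phaseSpace η)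
      simp only [nullState, Pi.add_apply, Pi.sub_apply]
      rw [eq_div_iff hε2]; linarith
    · ring
  · intro s
    by_cases hs : s ∈ S
    · obtain ⟨a, ha, b, hb, hta, htb, hor, hj⟩ := hJ s hs
      refine ⟨nullState ε a, nullState ε b, tendsto_nullState h0 h1 h.mem_phaseSpace ha hta,
        tendsto_nullState h0 h1 h.mem_phaseSpace hb htb, ?_, hj.isNullJump h0 h1 ha hb⟩
      rcases hor with e | e
      · exact Or.inl (congrArg _ e)
      · exact Or.inr (congrArg _ e)
    · have hc : Tendsto (fun η => cons ε (r η)) (𝓝 s) (𝓝 (cons ε (r s))) :=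
        (hS s hs).1.continuousAt
      have hp := h.mem_phaseSpace s
      refine ⟨nullState ε (r s), nullState ε (r s),
        tendsto_nullState h0 h1 h.mem_phaseSpace hp (hc.mono_left nhdsWithin_le_nhds),
        tendsto_nullState h0 h1 h.mem_phaseSpace hp (hc.mono_left nhdsWithin_le_nhds),
        Or.inl rfl, IsEntropyJump.isNullJump h0 h1 hp hp ⟨by simp, by simp, fun _ _ _ => by simp⟩⟩

/-! ### The invariant region and Riemann problems. -/

/-- The exponent of the boost factor in the Riemann invariants. -/
def invExponent (ε : ℝ) : ℝ := (1 + ε ^ 2) / (2 * ε)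

/-- The region where both Riemann invariants are bounded. -/
def invRegion (ε M : ℝ) : Set (ℝ × ℝ) :=
  {u | u ∈ phaseSpace ε ∧ (0 < u.1 → u.1 * boost ε u.2 ^ invExponent ε ≤ M ∧
    u.1 * (boost ε u.2)⁻¹ ^ invExponent ε ≤ M)}

lemma invExponent_pos (h0 : 0 < ε) : 0 < invExponent ε := by unfold invExponent; positivity

lemma invExponent_mul (h0 : 0 < ε) : invExponent ε * tameExponent ε = 1 := by
  have : 1 + ε ^ 2 ≠ 0 := by positivity
  unfold invExponent tameExponent; field_simp

lemma mul_rpow_invExponent {ρ y : ℝ} (h0 : 0 < ε) (hρ : 0 < ρ) (hy : 0 < y) :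
    (ρ * y ^ invExponent ε) ^ tameExponent ε = ρ ^ (tameExponent ε - 1) * (ρ * y) := by
  rw [Real.mul_rpow hρ.le (by positivity), ← Real.rpow_mul hy.le, invExponent_mul h0,
    Real.rpow_one, Real.rpow_sub_one hρ.ne']
  field_simp

lemma rinv_nullState {u : ℝ × ℝ} (h0 : 0 < ε) (hu : u ∈ interiorStates ε) :
    rinv ε (nullState ε u) = (u.1 * boost ε u.2 ^ invExponent ε) ^ tameExponent ε ∧
    rinv ε (mirror (nullState ε u)) =
      (u.1 * (boost ε u.2)⁻¹ ^ invExponent ε) ^ tameExponent ε := by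
  have hy := boost_pos h0 hu.2
  rw [mul_rpow_invExponent h0 hu.1 hy, mul_rpow_invExponent h0 hu.1 (inv_pos.2 hy)]
  simp [rinv, nullState, mirror, div_eq_mul_inv]

lemma mem_invRegion_of_rinv_le {u : ℝ × ℝ} {M : ℝ} (h0 : 0 < ε) (hM : 0 < M)
    (hu : u ∈ phaseSpace ε) (h1 : 0 < u.1 → rinv ε (nullState ε u) ≤ M ^ tameExponent ε)
    (h2 : 0 < u.1 → rinv ε (mirror (nullState ε u)) ≤ M ^ tameExponent ε) :
    u ∈ invRegion ε M := by
  refine ⟨hu, fun hpos => ?_⟩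
  have hi : u ∈ interiorStates ε := ⟨hpos, hu.2.2 hpos⟩
  have hy := boost_pos h0 hi.2
  have g1 := h1 hpos
  have g2 := h2 hpos
  rw [(rinv_nullState h0 hi).1] at g1
  rw [(rinv_nullState h0 hi).2] at g2
  exact ⟨(Real.rpow_le_rpow_iff (by positivity) hM.le (tameExponent_pos h0)).1 g1,
    (Real.rpow_le_rpow_iff (by positivity) hM.le (tameExponent_pos h0)).1 g2⟩

lemma rinv_le_of_mem_invRegion {u : ℝ × ℝ} {M : ℝ} (h0 : 0 < ε) (hM : 0 < M)
    (hu : u ∈ invRegion ε M) (hpos : 0 < u.1) :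
    rinv ε (nullState ε u) ≤ M ^ tameExponent ε ∧
    rinv ε (mirror (nullState ε u)) ≤ M ^ tameExponent ε := by
  have hi : u ∈ interiorStates ε := ⟨hpos, hu.1.2.2 hpos⟩
  have hy := boost_pos h0 hi.2
  rw [(rinv_nullState h0 hi).1, (rinv_nullState h0 hi).2]
  obtain ⟨g1, g2⟩ := hu.2 hpos
  exact ⟨(Real.rpow_le_rpow_iff (by positivity) hM.le (tameExponent_pos h0)).2 g1,
    (Real.rpow_le_rpow_iff (by positivity) hM.le (tameExponent_pos h0)).2 g2⟩

/-- The region is invariant under the solution of Riemann problems. -/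
theorem IsRiemannSolution.mem_invRegion {ul ur : ℝ × ℝ} {r : ℝ → ℝ × ℝ} {M : ℝ} (h0 : 0 < ε)
    (h1 : ε < 1) (hM : 0 < M) (h : IsRiemannSolution ε ul ur r) (hl : ul ∈ invRegion ε M)
    (hr : ur ∈ invRegion ε M) (ξ : ℝ) : r ξ ∈ invRegion ε M := by
  obtain ⟨g, S, hprof⟩ := h.exists_isProfile h0 h1
  have tl := tendsto_nullState h0 h1 h.mem_phaseSpace hl.1 h.left_data
  have tr := tendsto_nullState h0 h1 h.mem_phaseSpace hr.1 h.right_data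
  have hc : Continuous mirror := by unfold mirror; fun_prop
  refine mem_invRegion_of_rinv_le h0 hM (h.mem_phaseSpace ξ) (fun hpos => ?_) (fun hpos => ?_)
  · rcases hprof.rinv_le_data h0 h1 tl tr hpos with ⟨e1, e2⟩ | ⟨e1, e2⟩
    · exact e2.trans (rinv_le_of_mem_invRegion h0 hM hl e1).1
    · exact e2.trans (rinv_le_of_mem_invRegion h0 hM hr e1).1
  -- The second invariant is the first one of the reflected profile, whose left and right data are
  -- exchanged.
  · have tl' := ((hc.tendsto _).comp tl).comp tendsto_neg_atTop_atBot
    have tr' := ((hc.tendsto _).comp tr).comp tendsto_neg_atBot_atTop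
    have hpos' : 0 < (mirror (nullState ε (r (- -ξ)))).1 := by rwa [neg_neg]
    have := hprof.mirror.rinv_le_data (ξ := -ξ) h0 h1 tr' tl' hpos'
    rw [neg_neg] at this
    rcases this with ⟨e1, e2⟩ | ⟨e1, e2⟩
    · exact e2.trans (rinv_le_of_mem_invRegion h0 hM hr e1).2
    · exact e2.trans (rinv_le_of_mem_invRegion h0 hM hl e1).2

/-! ### Convexity of the region in the conservative variables, and cell averages. -/

/-- The boundary curve `ρ = M y^(-k)` has `G + εH` and `G - εH` proportional to `(y + d) y^(-k)` and
`(1/y + d) y^(-k)`. The coefficients annihilate its tangent at `y = z`, and for `k > 1` the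
functional increases up to `z` and decreases afterwards. -/
lemma rpow_neg_mul_le {k d z y : ℝ} (hk : 1 < k) (hd : 0 < d) (hz : 0 < z) (hy : 0 < y) :
    ((1 + k + k * d * z) * (y + d) - ((k - 1) * z ^ 2 + k * d * z) * (y⁻¹ + d)) * y ^ (-k) ≤
      (2 * z + d * z ^ 2 + d) * z ^ (-k) := by
  set f : ℝ → ℝ := fun y =>
    ((1 + k + k * d * z) * (y + d) - ((k - 1) * z ^ 2 + k * d * z) * (y⁻¹ + d)) * y ^ (-k) with hf
  have hfz : f z = (2 * z + d * z ^ 2 + d) * z ^ (-k) := by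
    simp only [hf]; field_simp; ring
  have hd' : ∀ x, 0 < x → HasDerivAt f (-(x ^ (-k) / x ^ 2 * ((x - z) *
      ((k ^ 2 - 1) * (x + z) + k * d * (k + 1) + k * d * (k - 1) * x * z)))) x := by
    intro x hx
    have e1 : HasDerivAt (fun y : ℝ => (1 + k + k * d * z) * (y + d) -
        ((k - 1) * z ^ 2 + k * d * z) * (y⁻¹ + d)) ((1 + k + k * d * z) * 1 -
        ((k - 1) * z ^ 2 + k * d * z) * (-(x ^ 2)⁻¹)) x :=
      (((hasDerivAt_id x).add_const d).const_mul _).sub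
        (((hasDerivAt_inv hx.ne').add_const d).const_mul _)
    refine (e1.mul (Real.hasDerivAt_rpow_const (p := -k) (Or.inl hx.ne'))).congr_deriv ?_
    rw [Real.rpow_sub_one hx.ne']
    field_simp
    ring
  have hpos : ∀ x, 0 < x →
      0 < (k ^ 2 - 1) * (x + z) + k * d * (k + 1) + k * d * (k - 1) * x * z := by
    intro x hx
    have h1 : 0 < k - 1 := by linarith
    have h2 : 0 < k ^ 2 - 1 := by nlinarith
    have h3 : 0 < k := by linarith
    positivity
  change f y ≤ _
  rw [← hfz]
  rcases le_total y z with h | h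
  · have hm : MonotoneOn f (Set.Icc y z) := by
      refine monotoneOn_of_deriv_nonneg (convex_Icc y z)
        (fun x hx => (hd' x (hy.trans_le hx.1)).continuousAt.continuousWithinAt) ?_ ?_ <;>
        rw [interior_Icc]
      · exact fun x hx => (hd' x (hy.trans hx.1)).differentiableAt.differentiableWithinAt
      · intro x hx
        have hx0 := hy.trans hx.1
        rw [(hd' x hx0).deriv, Left.nonneg_neg_iff]
        exact mul_nonpos_of_nonneg_of_nonpos (by positivity)
          (mul_nonpos_of_nonpos_of_nonneg (by linarith [hx.2]) (hpos x hx0).le)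
    exact hm ⟨le_rfl, h⟩ ⟨h, le_rfl⟩ h
  · have hm : AntitoneOn f (Set.Icc z y) := by
      refine antitoneOn_of_deriv_nonpos (convex_Icc z y)
        (fun x hx => (hd' x (hz.trans_le hx.1)).continuousAt.continuousWithinAt) ?_ ?_ <;>
        rw [interior_Icc]
      · exact fun x hx => (hd' x (hz.trans hx.1)).differentiableAt.differentiableWithinAt
      · intro x hx
        have hx0 := hz.trans hx.1
        rw [(hd' x hx0).deriv, Left.neg_nonpos_iff]
        exact mul_nonneg (by positivity) (mul_nonneg (by linarith [hx.1]) (hpos x hx0).le)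
    exact hm ⟨le_rfl, h⟩ ⟨h, le_rfl⟩ h

lemma one_lt_invExponent (h0 : 0 < ε) (h1 : ε < 1) : 1 < invExponent ε := by
  rw [invExponent, one_lt_div (by positivity)]; nlinarith

/-- The linear functional of the conservative variables supporting the region of bounded Riemann
invariant at the boost factor `z`. -/
def support (ε z : ℝ) (u : ℝ × ℝ) : ℝ :=
  (1 + invExponent ε + invExponent ε * del ε * z) * (G ε u + ε * H ε u) -
    ((invExponent ε - 1) * z ^ 2 + invExponent ε * del ε * z) * (G ε u - ε * H ε u)

lemma support_eq {u : ℝ × ℝ} (h0 : 0 < ε) (hu : u ∈ interiorStates ε) (z : ℝ) :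
    support ε z u = (1 + ε ^ 2) / 2 * (u.1 *
      ((1 + invExponent ε + invExponent ε * del ε * z) * (boost ε u.2 + del ε) -
      ((invExponent ε - 1) * z ^ 2 + invExponent ε * del ε * z) *
        ((boost ε u.2)⁻¹ + del ε))) := by
  have hp := interior_subset_phaseSpace hu
  have e1 := G_eq_null h0 hp
  have e2 := H_eq_null h0 hp
  have hy := boost_pos h0 hu.2
  have hε2 : 1 + ε ^ 2 ≠ 0 := by positivity
  have e3 : del ε * (1 + ε ^ 2) = 1 - ε ^ 2 := by unfold del; field_simp
  have e4 : G ε u + ε * H ε u = (1 + ε ^ 2) / 2 * (u.1 * (boost ε u.2 + del ε)) := by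
    rw [e1, e2]; linear_combination (-u.1 / 2) * e3
  have e5 : G ε u - ε * H ε u = (1 + ε ^ 2) / 2 * (u.1 * ((boost ε u.2)⁻¹ + del ε)) := by
    rw [e1, e2, div_eq_mul_inv u.1]; linear_combination (-u.1 / 2) * e3
  rw [support, e4, e5]; ring

lemma support_le {u : ℝ × ℝ} {z M : ℝ} (h0 : 0 < ε) (h1 : ε < 1) (hM : 0 < M) (hz : 0 < z)
    (hu : u ∈ phaseSpace ε) (h : 0 < u.1 → u.1 * boost ε u.2 ^ invExponent ε ≤ M) :
    support ε z u ≤ (1 + ε ^ 2) / 2 *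
      (M * ((2 * z + del ε * z ^ 2 + del ε) * z ^ (-invExponent ε))) := by
  have hd := del_pos h0 h1
  rcases mem_interior_or_vacuum hu with hi | hi
  · have hy := boost_pos h0 hi.2
    rw [support_eq h0 hi]
    refine mul_le_mul_of_nonneg_left ?_ (by positivity)
    have e1 := rpow_neg_mul_le (one_lt_invExponent h0 h1) hd hz hy
    have hp : 0 < boost ε u.2 ^ invExponent ε := Real.rpow_pos_of_pos hy _
    have hu1 := hi.1
    have e2 := mul_le_mul_of_nonneg_left e1 (mul_pos hu1 hp).le
    have e3 := mul_le_mul_of_nonneg_right (h hi.1)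
      (by positivity : 0 ≤ (2 * z + del ε * z ^ 2 + del ε) * z ^ (-invExponent ε))
    refine le_trans (le_of_eq ?_) (e2.trans e3)
    rw [Real.rpow_neg hy.le]
    field_simp
  · have : support ε z u = 0 := by simp [support, G, H, hi]
    rw [this]
    positivity

/-- Converse of `support_le`: of all the half-planes, the one belonging to the boost factor of the
state itself already gives back the bound on the invariant. -/
lemma le_of_support_le {u : ℝ × ℝ} {M : ℝ} (h0 : 0 < ε) (h1 : ε < 1)
    (hu : u ∈ interiorStates ε)
    (h : support ε (boost ε u.2) u ≤ (1 + ε ^ 2) / 2 * (M * ((2 * boost ε u.2 +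
      del ε * boost ε u.2 ^ 2 + del ε) * boost ε u.2 ^ (-invExponent ε)))) :
    u.1 * boost ε u.2 ^ invExponent ε ≤ M := by
  have hd := del_pos h0 h1
  have hy := boost_pos h0 hu.2
  rw [support_eq h0 hu, Real.rpow_neg hy.le] at h
  have h2 := le_of_mul_le_mul_left h (by positivity)
  have hp : 0 < boost ε u.2 ^ invExponent ε := Real.rpow_pos_of_pos hy _
  generalize boost ε u.2 ^ invExponent ε = P at *
  generalize boost ε u.2 = y at *
  have h3 := mul_le_mul_of_nonneg_left h2 hp.le
  have hc : 0 < 2 * y + del ε * y ^ 2 + del ε := by positivity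
  refine le_of_mul_le_mul_right ?_ hc
  refine le_trans (le_of_eq ?_) (h3.trans (le_of_eq ?_))
  · field_simp; ring
  · field_simp

open MeasureTheory in
lemma IsCellAverage.linear_le {h x₀ A B K : ℝ} {u : ℝ → ℝ × ℝ} {c : ℝ × ℝ} (hh : 0 < h)
    (hc : IsCellAverage ε h x₀ u c)
    (hG : IntervalIntegrable (fun x => G ε (u x)) volume (x₀ - h) (x₀ + h))
    (hH : IntervalIntegrable (fun x => H ε (u x)) volume (x₀ - h) (x₀ + h))
    (hle : ∀ x, A * G ε (u x) + B * H ε (u x) ≤ K) : A * G ε c + B * H ε c ≤ K := by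
  obtain ⟨-, e1, e2⟩ := hc
  have h1 : ∫ x in (x₀ - h)..(x₀ + h), (A * G ε (u x) + B * H ε (u x)) ≤
      ∫ _ in (x₀ - h)..(x₀ + h), K :=
    intervalIntegral.integral_mono_on (by linarith) ((hG.const_mul A).add (hH.const_mul B))
      intervalIntegrable_const fun x _ => hle x
  rw [intervalIntegral.integral_add (hG.const_mul A) (hH.const_mul B),
    intervalIntegral.integral_const_mul, intervalIntegral.integral_const_mul,
    intervalIntegral.integral_const, smul_eq_mul] at h1
  rw [e1, e2]
  have h2 := mul_le_mul_of_nonneg_left h1 (by positivity : 0 ≤ (2 * h)⁻¹)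
  refine le_trans (le_of_eq ?_) (h2.trans (le_of_eq ?_))
  · ring
  · field_simp; ring

lemma G_neg (ε ρ v : ℝ) : G ε (ρ, -v) = G ε (ρ, v) := by simp [G]

lemma H_neg (ε ρ v : ℝ) : H ε (ρ, -v) = -H ε (ρ, v) := by simp [H]

lemma mem_phaseSpace_neg {u : ℝ × ℝ} (hu : u ∈ phaseSpace ε) : (u.1, -u.2) ∈ phaseSpace ε := by
  simpa [phaseSpace] using hu

/-- Serves to make `G` and `H` integrable. Since the exponent exceeds `1`, whichever of `y` and
`1/y` is at least `1` is dominated by its power. -/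
lemma G_le_of_mem_invRegion {u : ℝ × ℝ} {M : ℝ} (h0 : 0 < ε) (h1 : ε < 1) (hM : 0 < M)
    (hu : u ∈ invRegion ε M) : G ε u ≤ M := by
  rcases mem_interior_or_vacuum hu.1 with hi | hi
  · have hy := boost_pos h0 hi.2
    obtain ⟨e1, e2⟩ := hu.2 hi.1
    have hk := (one_lt_invExponent h0 h1).le
    have hρ := hi.1
    have key : ∀ y : ℝ, 0 < y → u.1 * y ^ invExponent ε ≤ M →
        u.1 * y⁻¹ ^ invExponent ε ≤ M → u.1 ≤ M ∧ u.1 * y ≤ M := by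
      intro y hy e1 e2
      rcases le_total 1 y with h | h
      · have e3 : y ≤ y ^ invExponent ε := by
          simpa using Real.rpow_le_rpow_of_exponent_le h hk
        have e4 := (mul_le_mul_of_nonneg_left e3 hρ.le).trans e1
        exact ⟨(le_mul_of_one_le_right hρ.le h).trans e4, e4⟩
      · have h' := (one_le_inv₀ hy).2 h
        have e3 : y⁻¹ ≤ y⁻¹ ^ invExponent ε := by
          simpa using Real.rpow_le_rpow_of_exponent_le h' hk
        have e4 := (mul_le_mul_of_nonneg_left e3 hρ.le).trans e2
        have e5 := (le_mul_of_one_le_right hρ.le h').trans e4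
        exact ⟨e5, (mul_le_of_le_one_right hρ.le h).trans e5⟩
    obtain ⟨f1, f2⟩ := key _ hy e1 e2
    obtain ⟨-, f3⟩ := key _ (inv_pos.2 hy) e2 (by rwa [inv_inv])
    rw [G_eq_null h0 hu.1, div_eq_mul_inv u.1]
    have h2 : 0 ≤ 1 - ε ^ 2 := by nlinarith
    have g1 := mul_le_mul_of_nonneg_left f1 h2
    have g2 := mul_le_mul_of_nonneg_left f2 (by positivity : 0 ≤ 1 + ε ^ 2)
    have g3 := mul_le_mul_of_nonneg_left f3 (by positivity : 0 ≤ 1 + ε ^ 2)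
    linarith
  · have : G ε u = 0 := by simp [G, hi]
    rw [this]; exact hM.le

open MeasureTheory in
lemma intervalIntegrable_of_bounded {f : ℝ → ℝ} (hf : Measurable f) {K : ℝ}
    (hK : ∀ x, |f x| ≤ K) (a b : ℝ) : IntervalIntegrable f volume a b := by
  refine (intervalIntegrable_const (c := K)).mono_fun hf.aestronglyMeasurable ?_
  refine Eventually.of_forall fun x => ?_
  exact (hK x).trans (le_abs_self K)

/-- The region is stable under averaging of the conservative variables. -/
theorem IsCellAverage.mem_invRegion {h x₀ M : ℝ} {u : ℝ → ℝ × ℝ} {c : ℝ × ℝ} (h0 : 0 < ε)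
    (h1 : ε < 1) (hM : 0 < M) (hh : 0 < h) (hc : IsCellAverage ε h x₀ u c)
    (hG : Measurable fun x => G ε (u x)) (hH : Measurable fun x => H ε (u x))
    (hu : ∀ x, u x ∈ invRegion ε M) : c ∈ invRegion ε M := by
  have hGb : ∀ x, |G ε (u x)| ≤ M := fun x => by
    rw [abs_of_nonneg (G_nonneg h0 (hu x).1)]
    exact G_le_of_mem_invRegion h0 h1 hM (hu x)
  have hHb : ∀ x, |H ε (u x)| ≤ M / ε := fun x => by
    rw [le_div_iff₀ h0, mul_comm]
    exact (abs_H_le h0 h1 (hu x).1).trans (G_le_of_mem_invRegion h0 h1 hM (hu x))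
  have iG := intervalIntegrable_of_bounded hG hGb (x₀ - h) (x₀ + h)
  have iH := intervalIntegrable_of_bounded hH hHb (x₀ - h) (x₀ + h)
  refine ⟨hc.1, fun hpos => ?_⟩
  have hi : c ∈ interiorStates ε := ⟨hpos, hc.1.2.2 hpos⟩
  have hy := boost_pos h0 hi.2
  have hlin : ∀ z w, support ε z w =
      (1 + invExponent ε + invExponent ε * del ε * z -
        ((invExponent ε - 1) * z ^ 2 + invExponent ε * del ε * z)) * G ε w +
      ((1 + invExponent ε + invExponent ε * del ε * z +
        ((invExponent ε - 1) * z ^ 2 + invExponent ε * del ε * z)) * ε) * H ε w := by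
    intro z w; unfold support; ring
  constructor
  · refine le_of_support_le h0 h1 hi ?_
    rw [hlin]
    refine hc.linear_le hh iG iH fun x => ?_
    rw [← hlin]
    exact support_le h0 h1 hM hy (hu x).1 fun hp => ((hu x).2 hp).1
  -- The second invariant is the first one after reversing the velocity, which only changes the sign
  -- of `H` in the linear functional.
  · have hi' : (c.1, -c.2) ∈ interiorStates ε := by
      simpa [interiorStates] using hi
    have hneg : ∀ z w, support ε z (w.1, -w.2) =
        (1 + invExponent ε + invExponent ε * del ε * z -
          ((invExponent ε - 1) * z ^ 2 + invExponent ε * del ε * z)) * G ε w +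
        (-((1 + invExponent ε + invExponent ε * del ε * z +
          ((invExponent ε - 1) * z ^ 2 + invExponent ε * del ε * z)) * ε)) * H ε w := by
      intro z w
      rw [hlin, G_neg, H_neg]; ring
    have := le_of_support_le (M := M) h0 h1 hi' ?_
    · rwa [boost_neg] at this
    · rw [hneg]
      refine hc.linear_le hh iG iH fun x => ?_
      rw [← hneg]
      refine support_le h0 h1 hM (boost_pos h0 hi'.2) (mem_phaseSpace_neg (hu x).1) fun hp => ?_
      simp only [boost_neg]
      exact ((hu x).2 hp).2

lemma measurable_of_continuousAt_off_finite {f : ℝ → ℝ} (S : Finset ℝ)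
    (hf : ∀ x, x ∉ S → ContinuousAt f x) : Measurable f := by
  classical
  have h1 : Measurable (Set.piecewise ((S : Set ℝ)ᶜ) f fun _ => 0) :=
    ContinuousOn.measurable_piecewise (fun x hx => (hf x hx).continuousWithinAt)
      continuousOn_const S.finite_toSet.measurableSet.compl
  refine h1.measurable_of_countable_ne (S.countable_toSet.mono fun x hx => ?_)
  by_contra hxS
  exact hx (Set.piecewise_eq_of_mem _ _ _ hxS)

lemma IsRiemannSolution.measurable {ul ur : ℝ × ℝ} {r : ℝ → ℝ × ℝ}
    (h : IsRiemannSolution ε ul ur r) :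
    (Measurable fun ξ => G ε (r ξ)) ∧ Measurable fun ξ => H ε (r ξ) := by
  obtain ⟨S, hS, -⟩ := h.piecewise
  exact ⟨measurable_of_continuousAt_off_finite S fun ξ hξ => (hS ξ hξ).1.fst.continuousAt,
    measurable_of_continuousAt_off_finite S fun ξ hξ => (hS ξ hξ).1.snd.continuousAt⟩

/-! ### Comparison with tame regions, uniformly in `ε`. -/

/-- Boosts by a fixed velocity, to the power of the Riemann invariants, increase with `ε`. -/
lemma boost_rpow_mono {ε₀ v : ℝ} (h0 : 0 < ε) (hle : ε ≤ ε₀) (hv0 : 0 ≤ v) (hv : ε₀ * v < 1) :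
    boost ε v ^ invExponent ε ≤ boost ε₀ v ^ invExponent ε₀ := by
  have h0' : 0 < ε₀ := h0.trans_le hle
  have hεv : ε * v ≤ ε₀ * v := mul_le_mul_of_nonneg_right hle hv0
  have n1 : 0 ≤ ε * v := by positivity
  have n2 : 0 ≤ ε₀ * v := by positivity
  have s1 := (Real.hasSum_log_sub_log_of_abs_lt_one (x := ε * v)
    (by rw [abs_of_nonneg n1]; linarith)).mul_left (invExponent ε)
  have s2 := (Real.hasSum_log_sub_log_of_abs_lt_one (x := ε₀ * v)
    (by rw [abs_of_nonneg n2]; exact hv)).mul_left (invExponent ε₀)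
  -- The factor `1/(2e)` in the exponent cancels the odd power of `e` in the logarithmic series, so
  -- every term is nondecreasing in `e`.
  have hterm : ∀ (e : ℝ), 0 < e → ∀ n : ℕ,
      invExponent e * (2 * (1 / (2 * n + 1)) * (e * v) ^ (2 * n + 1)) =
      (1 + e ^ 2) * (1 / (2 * n + 1)) * (e ^ (2 * n) * v ^ (2 * n + 1)) := by
    intro e he n
    rw [invExponent, mul_pow, pow_succ e]
    field_simp
    ring
  have hs := hasSum_le (fun n => by
    rw [hterm ε h0, hterm ε₀ h0']
    have p1 := pow_le_pow_left₀ h0.le hle (2 * n)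
    have p2 := pow_le_pow_left₀ h0.le hle 2
    gcongr) s1 s2
  rw [← Real.log_div (by linarith) (by linarith), ← Real.log_div (by linarith) (by linarith)] at hs
  have b1 : 0 < boost ε v := div_pos (by linarith) (by linarith)
  have b2 : 0 < boost ε₀ v := div_pos (by linarith) (by linarith)
  rw [Real.rpow_def_of_pos b1, Real.rpow_def_of_pos b2, Real.exp_le_exp, mul_comm,
    mul_comm (Real.log _)]
  exact hs

/-- The factor `2 ^ invExponent ε₀` comes from bounding the numerator `1 + ε₀ |v|` of the boost by
`2`; the passage from `ε₀` to `ε` is free by `boost_rpow_mono`. -/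
lemma mem_invRegion_of_mem_tameRegion {ε₀ M : ℝ} {u : ℝ × ℝ} (h0 : 0 < ε) (hle : ε ≤ ε₀)
    (hM : 0 < M) (hu : u ∈ tameRegion ε₀ M) :
    u ∈ invRegion ε (2 ^ invExponent ε₀ * M) := by
  have h0' : 0 < ε₀ := h0.trans_le hle
  have hk := invExponent_pos h0
  have hk₀ := invExponent_pos h0'
  have hεv : ε * |u.2| ≤ ε₀ * |u.2| := mul_le_mul_of_nonneg_right hle (abs_nonneg _)
  have hnn : 0 ≤ (u.1 / M) ^ tameExponent ε₀ := Real.rpow_nonneg (div_nonneg hu.1 hM.le) _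
  have hpos : 0 < u.1 → ε₀ * |u.2| < 1 := fun hp => by
    have := Real.rpow_pos_of_pos (div_pos hp hM) (tameExponent ε₀)
    linarith [hu.2.2]
  refine ⟨⟨hu.1, by linarith [hu.2.2], fun hp => by linarith [hpos hp]⟩, fun hp => ?_⟩
  have hv := hpos hp
  have h2 : (1 : ℝ) ≤ 2 ^ invExponent ε₀ := Real.one_le_rpow (by norm_num) hk₀.le
  have hx : 0 < u.1 / M := div_pos hp hM
  have hX := Real.rpow_pos_of_pos hx (tameExponent ε₀)
  have hbig : u.1 * boost ε |u.2| ^ invExponent ε ≤ 2 ^ invExponent ε₀ * M := by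
    have e1 := boost_rpow_mono h0 hle (abs_nonneg u.2) hv
    have e2 : boost ε₀ |u.2| ≤ 2 / (u.1 / M) ^ tameExponent ε₀ := by
      unfold boost
      have := hu.2.2
      exact div_le_div₀ (by norm_num) (by linarith) hX this
    have b2 : 0 < boost ε₀ |u.2| := boost_pos h0' (by rwa [abs_abs])
    have e3 := Real.rpow_le_rpow b2.le e2 hk₀.le
    rw [Real.div_rpow (by norm_num) hX.le, ← Real.rpow_mul hx.le, mul_comm (tameExponent ε₀),
      invExponent_mul h0', Real.rpow_one] at e3
    have e4 := mul_le_mul_of_nonneg_left (e1.trans e3) hp.le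
    refine e4.trans (le_of_eq ?_)
    field_simp
  have hsmall : ∀ y : ℝ, 0 < y → y ≤ 1 → u.1 * y ^ invExponent ε ≤ 2 ^ invExponent ε₀ * M := by
    intro y hy0 hy1
    have e1 := mul_le_of_le_one_right hp.le (Real.rpow_le_one hy0.le hy1 hk.le)
    exact e1.trans (hu.2.1.trans (le_mul_of_one_le_left hM.le h2))
  have hv' : ε * |u.2| < 1 := by linarith
  have hy := boost_pos h0 hv'
  have hone : ∀ w : ℝ, 0 ≤ w → ε * w < 1 → 1 ≤ boost ε w := fun w hw0 hw => by
    have : 0 ≤ ε * w := by positivity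
    rw [boost, one_le_div (by linarith)]; linarith
  rcases le_total 0 u.2 with hs | hs
  · rw [abs_of_nonneg hs] at hbig hv'
    exact ⟨hbig, hsmall _ (inv_pos.2 hy) (inv_le_one_of_one_le₀ (hone _ hs hv'))⟩
  · rw [abs_of_nonpos hs] at hbig hv'
    have e1 := hone _ (by linarith) hv'
    rw [boost_neg] at hbig e1
    refine ⟨hsmall _ hy ?_, hbig⟩
    rw [← inv_inv (boost ε u.2)]
    exact inv_le_one_of_one_le₀ e1

/-- No constant is lost, because the inverse boost `(1 - ε|v|)/(1 + ε|v|)` is at most `1 - ε|v|`. -/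
lemma mem_tameRegion_of_mem_invRegion {M : ℝ} {u : ℝ × ℝ} (h0 : 0 < ε) (hM : 0 < M)
    (hu : u ∈ invRegion ε M) : u ∈ tameRegion ε M := by
  have hc := tameExponent_pos h0
  rcases mem_interior_or_vacuum hu.1 with hi | hi
  · obtain ⟨e1, e2⟩ := hu.2 hi.1
    have hp := hi.1
    have hbig : u.1 * boost ε |u.2| ^ invExponent ε ≤ M := by
      rcases le_total 0 u.2 with hs | hs
      · rwa [abs_of_nonneg hs]
      · rwa [abs_of_nonpos hs, boost_neg]
    have hv := hi.2
    have hn : 0 ≤ ε * |u.2| := by positivity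
    have hy : 0 < boost ε |u.2| := boost_pos h0 (by rwa [abs_abs])
    have hy1 : 1 ≤ boost ε |u.2| := by
      rw [boost, one_le_div (by linarith)]; linarith
    refine ⟨hp.le, ?_, ?_⟩
    · exact (le_mul_of_one_le_right hp.le
        (Real.one_le_rpow hy1 (invExponent_pos h0).le)).trans hbig
    · have hP : 0 < boost ε |u.2| ^ invExponent ε := Real.rpow_pos_of_pos hy _
      have e3 : u.1 / M ≤ (boost ε |u.2| ^ invExponent ε)⁻¹ := by
        rw [div_le_iff₀ hM, inv_mul_eq_div, le_div_iff₀ hP]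
        exact hbig
      have e4 := Real.rpow_le_rpow (by positivity) e3 hc.le
      rw [Real.inv_rpow hP.le, ← Real.rpow_mul hy.le, invExponent_mul h0, Real.rpow_one] at e4
      refine e4.trans ?_
      rw [boost, inv_div]
      exact div_le_self (by linarith) (by linarith)
  · refine ⟨hu.1.1, by rw [hi]; exact hM.le, ?_⟩
    rw [hi, zero_div, Real.zero_rpow hc.ne']
    linarith [hu.1.2.1]

/-! ### Induction over the time steps. -/

/-- All the values of a Lax-Friedrichs approximation lie in the invariant region of its data. -/
theorem IsLaxFriedrichs.mem_invRegion {τ h M : ℝ} {u₀ : ℝ → ℝ × ℝ} {uh : ℝ → ℝ → ℝ × ℝ}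
    (h0 : 0 < ε) (h1 : ε < 1) (hM : 0 < M) (hτ : 0 < τ) (hh : 0 < h) (hm : Measurable u₀)
    (hu₀ : ∀ x, u₀ x ∈ invRegion ε M) (hLF : IsLaxFriedrichs ε τ h u₀ uh) {t : ℝ} (ht : 0 ≤ t)
    (x : ℝ) : uh t x ∈ invRegion ε M := by
  obtain ⟨cell, hinit, hcell, hstep⟩ := hLF
  have hcells : ∀ (n : ℕ) (j : ℤ), Even ((n : ℤ) + j) → cell n j ∈ invRegion ε M := by
    intro n
    induction n with
    | zero =>
      intro j hj
      refine (hinit j (by simpa using hj)).mem_invRegion h0 h1 hM hh ?_ ?_ hu₀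
      · have : Measurable (G ε) := by unfold G; fun_prop
        exact this.comp hm
      · have : Measurable (H ε) := by unfold H; fun_prop
        exact this.comp hm
    | succ n ih =>
      intro j hj
      have hj1 : Even ((n : ℤ) + (j - 1)) := by
        push_cast at hj
        have : (n : ℤ) + (j - 1) = (n + 1 + j) - 2 := by ring
        rw [this]
        exact hj.sub even_two
      have hj2 : Even ((n : ℤ) + (j - 1 + 2)) := by
        rw [← add_assoc]; exact hj1.add even_two
      obtain ⟨r, hr, -, hav⟩ := hstep n (j - 1) hj1
      rw [sub_add_cancel] at hav
      have haff : Measurable fun x : ℝ => (x - (((j - 1 : ℤ) : ℝ) + 1) * h) / τ := by fun_prop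
      exact hav.mem_invRegion h0 h1 hM hh (hr.measurable.1.comp haff)
        (hr.measurable.2.comp haff) fun x => hr.mem_invRegion h0 h1 hM (ih _ hj1) (ih _ hj2) _
  have hpar : ∀ (n : ℕ) (y : ℝ), ∃ j : ℤ, Even ((n : ℤ) + j) ∧ y ∈ Set.Ico (j : ℝ) (j + 2) := by
    intro n y
    have f1 := Int.floor_le y
    have f2 := Int.lt_floor_add_one y
    rcases Int.even_or_odd ((n : ℤ) + ⌊y⌋) with he | ho
    · exact ⟨⌊y⌋, he, f1, by linarith⟩
    · refine ⟨⌊y⌋ - 1, ?_, ?_, ?_⟩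
      · rw [← add_sub_assoc]; exact ho.sub_odd odd_one
      · push_cast; linarith
      · push_cast; linarith
  set n := ⌊t / τ⌋₊ with hn
  have hn1 : (n : ℝ) * τ ≤ t := by
    rw [← le_div_iff₀ hτ]; exact Nat.floor_le (by positivity)
  have hn2 : t < (n + 1 : ℝ) * τ := by
    rw [← div_lt_iff₀ hτ]; exact Nat.lt_floor_add_one _
  rcases hn1.eq_or_lt with heq | hlt
  -- At a grid time the cells are `[xⱼ₋₁, xⱼ₊₁)`, so the left end point has the parity of `n + 1`.
  · obtain ⟨j, hj, hy1, hy2⟩ := hpar (n + 1) (x / h)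
    rw [le_div_iff₀ hh] at hy1
    rw [div_lt_iff₀ hh] at hy2
    have hj' : Even ((n : ℤ) + (j + 1)) := by
      push_cast at hj
      rwa [add_right_comm, add_assoc] at hj
    have := hcell n (j + 1) hj' x ⟨by push_cast; linarith, by push_cast; linarith⟩
    rw [← heq, this]
    exact hcells n _ hj'
  · obtain ⟨j, hj, hy1, hy2⟩ := hpar n (x / h)
    rw [le_div_iff₀ hh] at hy1
    rw [div_lt_iff₀ hh] at hy2
    have hj2 : Even ((n : ℤ) + (j + 2)) := by
      rw [← add_assoc]; exact hj.add even_two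
    obtain ⟨r, hr, hval, -⟩ := hstep n j hj
    rw [hval t ⟨hlt, hn2⟩ x ⟨hy1, hy2⟩]
    exact hr.mem_invRegion h0 h1 hM (hcells n j hj) (hcells n _ hj2) _

end RelEuler

end

theorem lemma5p2 (ε₀ : ℝ) (hε₀ : 0 < ε₀) (hε₀' : ε₀ < 1)
    (ρ₀ v₀ : ℝ → ℝ) (hdata : RelEuler.IsTameData ε₀ (fun x => (ρ₀ x, v₀ x))) :
    ∃ M : ℝ, 0 < M ∧
      ∀ ε : ℝ, 0 < ε → ε ≤ ε₀ →
      ∀ τ h : ℝ, 0 < τ → 0 < h →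
      ∀ ρh vh : ℝ → ℝ → ℝ,
        RelEuler.IsLaxFriedrichs ε τ h (fun x => (ρ₀ x, v₀ x)) (fun t x => (ρh t x, vh t x)) →
        RelEuler.CFL ε τ h (fun t x => (ρh t x, vh t x)) →
        ∀ t x : ℝ, 0 ≤ t →
          0 ≤ ρh t x ∧ ρh t x ≤ M ∧
          1 - ε * |vh t x| ≥ (ρh t x / M) ^ (2 * ε / (1 + ε ^ 2)) := by
  obtain ⟨hm, M₀, hM₀, htame⟩ := hdata
  have hM : 0 < 2 ^ RelEuler.invExponent ε₀ * M₀ := by positivity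
  refine ⟨_, hM, fun ε h0 hle τ h hτ hh ρh vh hLF _ t x ht => ?_⟩
  exact RelEuler.mem_tameRegion_of_mem_invRegion h0 hM
    (hLF.mem_invRegion h0 (hle.trans_lt hε₀') hM hτ hh hm
      (fun y => RelEuler.mem_invRegion_of_mem_tameRegion h0 hle hM₀ (htame y)) ht x)
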